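/- Write points of $\mathbb R\times\mathbb R^2$ as $(t,\xi)$ or $(x_3,x_{12})$, with dual variables $(\omega,\sigma)$ or $(\varrho,\sigma)$, and let $(\mathcal F f)(\eta)=(2\pi)^{-3/2}\int f(x)e^{i\eta\cdot x}\,dx$, extended to tempered distributions by $\langle\mathcal F g,\varphi\rangle=\langle g,\mathcal F\varphi\rangle$. Let $\mathcal S=\mathcal S(\mathbb R\times\mathbb R^2)$ be the complex Schwartz space, let $\mathcal S_e$ and $\mathcal S_o$ be its subspaces of functions even, respectively odd, in the first variable, and let $\mathcal S(\mathbb R^+\times\mathbb R^2)\subset\mathcal S$ be the subspace of functions supported in $\{t\ge 0\}$. Let $\mathcal S'_{\rm cone}$ be the space of tempered distributions $g$ on $\mathbb R\times\mathbb R^2$ that are supported in $\{t\ge0\}$ and whose Fourier transform vanishes on the open set $\{|\omega|<|\sigma|\}$. For $\varphi\in\mathcal S$ put $$(R^*\varphi)(x)=\frac1{4\pi}\int_{\mathbb R^2}\frac{\varphi(|x-\xi|,\xi)}{|x-\xi|}\,d\xi ,\qquad x\in\mathbb R\times\mathbb R^2,$$ where in $|x-\xi|$ the point $\xi\in\mathbb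 R^2$ is identified with $(0,\xi)$; this depends only on $\varphi|_{t>0}$. (1) $R^*$ restricts to a continuous linear map $\mathcal S(\mathbb R^+\times\mathbb R^2)\to\mathcal S_e$, and for $\varphi\in\mathcal S(\mathbb R^+\times\mathbb R^2)$ and $(\varrho,\sigma)\ne 0$, with $r=\sqrt{|\sigma|^2+\varrho^2}$, $$(\mathcal F R^*\varphi)(\varrho,\sigma)=\frac1{2i}\,\frac{\mathcal F\varphi(r,\sigma)-\mathcal F\varphi(-r,\sigma)}{r}.$$ (2) There is a continuous linear map $E_2:\mathcal S_e\to\mathcal S$ with $E_2\psi(\omega,\sigma)=\psi(\sqrt\omega,\sigma)$ for all $\omega\ge0$, $\sigma\in\mathbb R^2$, and there is a continuous linear map $E_1:\mathcal S\to\mathcal S_o$ with $E_1\chi(\omega,\sigma)=\omega\,\chi(\omega^2-|\sigma|^2,\sigma)$ for all $(\omega,\sigma)$. For every constant $c\in\mathbb C$ (for instance $c=8\pi i$ or $c=2i$) there is a continuous linear map $E:\mathcal S_e\to\mathcal S_o$ with $\mathcal F E\psi=c\,E_1E_2\mathcal F\psi$ for all $\psi\in\mathcal S_e$, and it satisfies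 $$(\mathcal F E\psi)(\omega,\sigma)=c\,\omega\,(\mathcal F\psi)\big(\operatorname{sgn}(\omega)\sqrt{\omega^2-|\sigma|^2},\,\sigma\big)\qquad\text{for } |\omega|\ge|\sigma|,\ \psi\in\mathcal S_e. \tag{$*$}$$ (3) Every continuous linear map $E:\mathcal S_e\to\mathcal S_o$ that satisfies $(*)$ with $c=2i$ is an inverse of $R^*$ in the following sense: $R^*E\psi=\psi$ for all $\psi\in\mathcal S_e$, and $\langle g,ER^*\varphi\rangle=\langle g,\varphi\rangle$ for all $g\in\mathcal S'_{\rm cone}$ and all $\varphi\in\mathcal S(\mathbb R^+\times\mathbb R^2)$. -/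

import Mathlib

open MeasureTheory SchwartzMap FourierTransform TemperedDistribution Distribution

noncomputable section

namespace ConeInverse

/-- The plane `ℝ²` with its Euclidean norm. -/
abbrev Plane : Type := EuclideanSpace ℝ (Fin 2)

/-- `ℝ × ℝ²` with its Euclidean structure (so it is `ℝ³`). The first coordinate is the
distinguished one: the points are `(t, ξ)` on the data side, `(x₃, x₁₂)` on the source side, and
`(ω, σ)`, respectively `(ϱ, σ)`, on the frequency side. -/
abbrev Space : Type := WithLp 2 (ℝ × Plane)

/-- The point `(a, v)` of `ℝ × ℝ²`. -/
def pt (a : ℝ) (v : Plane) : Space := WithLp.toLp 2 (a, v)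

/-- The dilation of `ℝ × ℝ²` by the factor `(2π)⁻¹`. -/
def dilation : Space ≃L[ℝ] Space :=
  ContinuousLinearEquiv.smulLeft
    (Units.mk0 ((2 * Real.pi)⁻¹ : ℝ) (inv_ne_zero (mul_pos two_pos Real.pi_pos).ne'))

/-- The Fourier transform `(F f)(η) = (2π)^(-3/2) ∫ f(x) exp(i η·x) dx` as a continuous linear map
of the Schwartz space. It is a rescaling of Mathlib's `𝓕⁻`; the integral formula is
`fourierS_apply` below. -/
def fourierS : 𝓢(Space, ℂ) →L[ℂ] 𝓢(Space, ℂ) :=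
  (((2 * Real.pi) ^ (-(3 / 2) : ℝ) : ℝ) : ℂ) •
    ((compCLMOfContinuousLinearEquiv ℂ dilation).comp
      (fourierInvCLM ℂ 𝓢(Space, ℂ)))

theorem dilation_apply (x : Space) : dilation x = ((2 * Real.pi)⁻¹ : ℝ) • x := rfl

theorem fourierS_apply (f : 𝓢(Space, ℂ)) (η : Space) :
    fourierS f η = (((2 * Real.pi) ^ (-(3 / 2) : ℝ) : ℝ) : ℂ) *
      ∫ x : Space, f x * Complex.exp (Complex.I * (inner ℝ η x : ℝ)) := by
  have h : fourierS f η = (((2 * Real.pi) ^ (-(3 / 2) : ℝ) : ℝ) : ℂ) *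
      (𝓕⁻ (f : Space → ℂ)) (((2 * Real.pi)⁻¹ : ℝ) • η) := by
    rw [← SchwartzMap.fourierInv_coe]
    rfl
  rw [h, Real.fourierInv_eq']
  congr 1
  refine integral_congr_ae (Filter.Eventually.of_forall fun x => ?_)
  have hpi : (Real.pi : ℂ) ≠ 0 := by exact_mod_cast Real.pi_ne_zero
  simp only [inner_smul_right, smul_eq_mul, real_inner_comm x η]
  rw [mul_comm]
  congr 2
  push_cast
  field_simp

/-- The Fourier transform of tempered distributions, `⟨F g, φ⟩ = ⟨g, F φ⟩`. -/
def fourierD (g : 𝓢'(Space, ℂ)) : 𝓢'(Space, ℂ) :=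
  PointwiseConvergenceCLM.precomp ℂ fourierS g

/-- The Schwartz functions that are even in the first variable. -/
def SEven : Submodule ℂ 𝓢(Space, ℂ) where
  carrier := {f | ∀ a v, f (pt (-a) v) = f (pt a v)}
  add_mem' hf hg a v := by simp [hf a v, hg a v]
  zero_mem' a v := by simp
  smul_mem' c f hf a v := by simp [hf a v]

/-- The Schwartz functions that are odd in the first variable. -/
def SOdd : Submodule ℂ 𝓢(Space, ℂ) where
  carrier := {f | ∀ a v, f (pt (-a) v) = -f (pt a v)}
  add_mem' hf hg a v := by simp [hf a v, hg a v, add_comm]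
  zero_mem' a v := by simp
  smul_mem' c f hf a v := by simp [hf a v]

/-- `𝓢(ℝ⁺ × ℝ²)`: the Schwartz functions on `ℝ × ℝ²` supported in `{(t, ξ) | 0 ≤ t}`. -/
def SPlus : Submodule ℂ 𝓢(Space, ℂ) where
  carrier := {f | ∀ a v, a < 0 → f (pt a v) = 0}
  add_mem' hf hg a v ha := by simp [hf a v ha, hg a v ha]
  zero_mem' a v _ := by simp
  smul_mem' c f hf a v ha := by simp [hf a v ha]

/-- The reflection `(a, v) ↦ (-a, v)`. -/
def reflect : Space ≃ₗᵢ[ℝ] Space :=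
  LinearIsometryEquiv.withLpProdCongr 2 (LinearIsometryEquiv.neg ℝ)
    (LinearIsometryEquiv.refl ℝ Plane)

theorem reflect_pt (a : ℝ) (v : Plane) : reflect (pt a v) = pt (-a) v := rfl

theorem reflect_reflect (x : Space) : reflect (reflect x) = x := by
  have : x = pt x.fst x.snd := rfl
  rw [this, reflect_pt, reflect_pt, neg_neg]

theorem fourierS_mem_SEven {f : 𝓢(Space, ℂ)} (hf : f ∈ SEven) : fourierS f ∈ SEven := by
  intro a v
  rw [← reflect_pt, fourierS_apply, fourierS_apply]
  congr 1
  rw [← (reflect.measurePreserving).integral_comp reflect.toHomeomorph.measurableEmbedding]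
  refine integral_congr_ae (Filter.Eventually.of_forall fun x => ?_)
  have hx : f (reflect x) = f x := hf x.fst x.snd
  simp only [LinearIsometryEquiv.inner_map_map, hx]

/-- The Fourier transform as a continuous linear map of the even Schwartz functions. -/
def fourierEven : SEven →L[ℂ] SEven :=
  (fourierS.comp SEven.subtypeL).codRestrict SEven fun f => fourierS_mem_SEven f.2

/-- The adjoint `R*` of the spherical mean operator with centres on the plane `x₃ = 0`:
`(R* φ)(x) = 1/(4π) ∫_{ℝ²} φ(|x - ξ|, ξ) / |x - ξ| dξ`, where `ξ` stands for the point
`(0, ξ)`. Only the values of `φ` at positive first coordinate enter. -/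
def rStar (φ : 𝓢(Space, ℂ)) (x : Space) : ℂ :=
  (1 / (4 * Real.pi) : ℂ) *
    ∫ ξ : Plane, φ (pt ‖x - pt 0 ξ‖ ξ) / (‖x - pt 0 ξ‖ : ℂ)

/-- `𝓢'_cone(ℝ⁺ × ℝ²)`: the tempered distributions supported in `{(t, ξ) | 0 ≤ t}` whose Fourier
transform vanishes on the open set `|ω| < |σ|`. -/
def SCone : Set 𝓢'(Space, ℂ) :=
  {g | IsVanishingOn g {x : Space | x.fst < 0} ∧
    IsVanishingOn (fourierD g) {η : Space | |η.fst| < ‖η.snd‖}}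

/-- `F(Eψ)(ω, σ) = c ω · Fψ(sgn ω · √(ω² - |σ|²), σ)` for every even `ψ`, on the closed cone
`|ω| ≥ |σ|`. -/
def ConeFormula (c : ℂ) (E : SEven →L[ℂ] SOdd) : Prop :=
  ∀ (ψ : SEven) (ω : ℝ) (σ : Plane), ‖σ‖ ≤ |ω| →
    fourierS (E ψ) (pt ω σ) =
      c * ω * fourierS ψ (pt (Real.sign ω * √(ω ^ 2 - ‖σ‖ ^ 2)) σ)

end ConeInverse

end

open ConeInverse

/-! On the Fourier side `R*` is a change of variables. For odd `φ` and `r = √(ϱ² + |σ|²)`, the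
transform of `R* φ` at `(ϱ, σ)` is `Fφ(r, σ) / (2i r)`. For fixed `ξ` the integrand of `R*` is a
radial function of `x - ξ`, and the transform of a radial function on `ℝ³` reduces to a
one-dimensional one (`integral_norm_sq_mul_exp`). A `φ` supported in `t ≥ 0` may be replaced by the
odd function `φ(t, ξ) - φ(-t, ξ)`, since `R*` sees only `t > 0`; this produces the difference
quotient. Formula `(*)` with `c = 2i` is the same change of variables solved for the other side, so
`R* E ψ = ψ` follows by Fourier inversion.

The analytic core is that an even Schwartz function of `ω` is a Schwartz function of `ω²`,
continuously in the function. Write an odd `φ` as a sine transform of `v = F⁻¹φ`. Then `φ(t, σ) / t`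
is a constant times `∫ S(t² y²) y v(y, ζ) exp(i σ·ζ)` with `S(x) = sin √x / √x` entire, and
replacing `t²` by a real variable `s` gives the extension (`mul_sqrtQuot`). Smoothness, decay and
continuity are proved together for a class of operators closed under derivatives and under
multiplication by coordinates (`seminormBounded_of_class`, `SqrtClass`). Composition with `(ω² ±
|σ|², σ)` then gives `E₁`, and also shows that `R* φ` is Schwartz (`rStarOdd`).

For `⟨g, E R* φ⟩ = ⟨g, φ⟩`, the transforms of `E R* φ` and of `φ(t, ξ) - φ(-t, ξ)` agree on the
closed cone `|σ| ≤ |ω|`, while `Fg` vanishes on its complement. The difference is only flat on the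
boundary of the cone, not supported away from it, so a quantitative cutoff argument is needed
(`Distribution.IsVanishingOn.apply_eq_zero`). The same argument shows that `g` kills the reflected
function `φ(-t, ξ)`. -/

noncomputable section

namespace ConeInverse

open Filter Topology

/-! ### The entire function `sin √x / √x` and bounds for its derivatives. -/

section Smooth

open scoped ContDiff

/-- The coefficients of the entire function `sin √x / √x`. -/
def sincSqrtCoeff (n : ℕ) : ℝ := (-1) ^ n / (2 * n + 1).factorial

/-- The entire function `sin √x / √x` on the real line. -/
def sincSqrt : ℝ → ℝ := FormalMultilinearSeries.ofScalarsSum sincSqrtCoeff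

/-- The ratio test gives infinite radius of convergence. -/
theorem sincSqrt_contDiff {n : WithTop ℕ∞} : ContDiff ℝ n sincSqrt := by
  have hr : (FormalMultilinearSeries.ofScalars ℝ sincSqrtCoeff).radius = ⊤ := by
    refine FormalMultilinearSeries.ofScalars_radius_eq_top_of_tendsto ℝ _
      (Eventually.of_forall fun n => ?_) ?_
    · unfold sincSqrtCoeff; positivity
    · have h : ∀ n : ℕ, ‖sincSqrtCoeff n.succ‖ / ‖sincSqrtCoeff n‖ ≤ 1 / ((n : ℝ) + 1) := by
        intro n
        have h1 : (2 * (n.succ) + 1).factorial = (2 * n + 3) * ((2 * n + 2) *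
            (2 * n + 1).factorial) := by
          rw [show 2 * n.succ + 1 = 2 * n + 1 + 1 + 1 by omega, Nat.factorial_succ,
            Nat.factorial_succ]
        unfold sincSqrtCoeff
        rw [h1]
        simp only [norm_div, norm_pow, norm_neg, norm_one, one_pow, Real.norm_natCast]
        push_cast
        have : (0 : ℝ) < (2 * n + 1).factorial := by positivity
        have hn : (0 : ℝ) ≤ n := by positivity
        rw [div_div_eq_mul_div, div_one, one_div_mul_eq_div,
          div_le_div_iff₀ (by positivity) (by positivity)]
        have h2 : (n : ℝ) + 1 ≤ (2 * n + 3) * (2 * n + 2) := by nlinarith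
        nlinarith [mul_le_mul_of_nonneg_left h2 this.le]
      exact squeeze_zero (fun n => by positivity) h tendsto_one_div_add_atTop_nhds_zero_nat
  have h := (FormalMultilinearSeries.ofScalars ℝ sincSqrtCoeff).hasFPowerSeriesOnBall
    (by rw [hr]; simp)
  have h' := h.analyticOnNhd
  rw [hr, Metric.eball_top] at h'
  exact h'.contDiff

theorem mul_sincSqrt_sq (x : ℝ) : x * sincSqrt (x ^ 2) = Real.sin x := by
  unfold sincSqrt
  rw [FormalMultilinearSeries.ofScalarsSum_eq_tsum, ← (Real.hasSum_sin x).tsum_eq, ← tsum_mul_left]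
  refine tsum_congr fun n => ?_
  simp only [sincSqrtCoeff, smul_eq_mul]
  ring

theorem hasDerivAt_iteratedDeriv_sincSqrt (j : ℕ) (x : ℝ) :
    HasDerivAt (iteratedDeriv j sincSqrt) (iteratedDeriv (j + 1) sincSqrt x) x := by
  rw [iteratedDeriv_succ]
  exact ((sincSqrt_contDiff (n := ∞)).differentiable_iteratedDeriv j
    (mod_cast WithTop.coe_lt_top _) x).hasDerivAt

/-- Derivative of `t S(t²) = sin t`. -/
theorem cos_eq_sincSqrt (t : ℝ) :
    Real.cos t = sincSqrt (t ^ 2) + 2 * t ^ 2 * iteratedDeriv 1 sincSqrt (t ^ 2) := by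
  have h0 := hasDerivAt_iteratedDeriv_sincSqrt 0 (t ^ 2)
  rw [iteratedDeriv_zero] at h0
  have h1 := (hasDerivAt_id t).mul
    (HasDerivAt.comp (h := fun x : ℝ => x ^ 2) t h0 (hasDerivAt_pow 2 t))
  have h2 : (id * (sincSqrt ∘ fun x => x ^ 2)) = Real.sin := by
    funext x; exact mul_sincSqrt_sq x
  rw [h2] at h1
  rw [(Real.hasDerivAt_sin t).unique h1]
  simp
  ring

/-- For `j = 0` this is `cos' = -sin` written in the variable `x = t²`; the higher cases follow by
differentiating the equation, which holds near every `x > 0`. -/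
theorem sincSqrt_ode (j : ℕ) {x : ℝ} (hx : 0 < x) :
    4 * x * iteratedDeriv (j + 2) sincSqrt x + (4 * j + 6) * iteratedDeriv (j + 1) sincSqrt x
      + iteratedDeriv j sincSqrt x = 0 := by
  induction j generalizing x with
  | zero =>
    obtain ⟨t, ht, rfl⟩ : ∃ t : ℝ, 0 < t ∧ t ^ 2 = x :=
      ⟨√x, Real.sqrt_pos.2 hx, Real.sq_sqrt hx.le⟩
    have h0 := HasDerivAt.comp (h := fun x : ℝ => x ^ 2) t
      (hasDerivAt_iteratedDeriv_sincSqrt 0 (t ^ 2)) (hasDerivAt_pow 2 t)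
    have h1 := HasDerivAt.comp (h := fun x : ℝ => x ^ 2) t
      (hasDerivAt_iteratedDeriv_sincSqrt 1 (t ^ 2)) (hasDerivAt_pow 2 t)
    rw [iteratedDeriv_zero] at h0
    have h2 := h0.add (((hasDerivAt_pow 2 t).const_mul 2).mul h1)
    have h3 : (sincSqrt ∘ fun x => x ^ 2) +
        (fun y => 2 * y ^ 2) * (iteratedDeriv 1 sincSqrt ∘ fun x => x ^ 2) = Real.cos := by
      funext x; exact (cos_eq_sincSqrt x).symm
    rw [h3] at h2
    have h4 := (Real.hasDerivAt_cos t).unique h2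
    rw [← mul_sincSqrt_sq] at h4
    simp only [iteratedDeriv_zero, Function.comp] at h4 ⊢
    apply mul_left_cancel₀ ht.ne'
    push_cast at h4 ⊢
    linear_combination -h4
  | succ j ih =>
    have h1 := (((hasDerivAt_id x).const_mul 4).mul
      (hasDerivAt_iteratedDeriv_sincSqrt (j + 2) x)).add
      ((hasDerivAt_iteratedDeriv_sincSqrt (j + 1) x).const_mul (4 * j + 6 : ℝ)) |>.add
      (hasDerivAt_iteratedDeriv_sincSqrt j x)
    have h2 := h1.congr_of_eventuallyEq (f₁ := fun _ => (0 : ℝ)) <| by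
      filter_upwards [lt_mem_nhds hx] with y hy using (ih hy).symm
    have h3 := (hasDerivAt_const x (0 : ℝ)).unique h2
    simp only [id] at h3
    push_cast
    linear_combination -h3

/-- The differential equation bounds the derivative of order `j + 2` by the two preceding ones
divided by `x`. The cases `0` and `1` come from `|sin| ≤ 1` and `|cos| ≤ 1`. -/
theorem exists_bound_iteratedDeriv_sincSqrt (j : ℕ) :
    ∃ C, ∀ x, 1 ≤ x → |iteratedDeriv j sincSqrt x| ≤ C := by
  have h0 : ∀ x : ℝ, 1 ≤ x → |sincSqrt x| ≤ 1 := by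
    intro x hx
    have h1 := mul_sincSqrt_sq √x
    rw [Real.sq_sqrt (by linarith)] at h1
    have h2 : 1 ≤ √x := by rwa [Real.one_le_sqrt]
    have h3 := Real.abs_sin_le_one √x
    rw [← h1, abs_mul, abs_of_nonneg (by positivity)] at h3
    nlinarith [abs_nonneg (sincSqrt x)]
  induction j using Nat.strong_induction_on with
  | _ j ih =>
    match j with
    | 0 => exact ⟨1, by simpa using h0⟩
    | 1 =>
      refine ⟨1, fun x hx => ?_⟩
      have h1 := cos_eq_sincSqrt √x
      rw [Real.sq_sqrt (by linarith)] at h1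
      have h3 := Real.abs_cos_le_one √x
      have h4 : 2 * x * iteratedDeriv 1 sincSqrt x = Real.cos √x - sincSqrt x := by
        rw [h1]; ring
      have h5 : |2 * x * iteratedDeriv 1 sincSqrt x| ≤ 2 := by
        rw [h4]; exact (abs_sub _ _).trans (by linarith [h0 x hx])
      rw [abs_mul, abs_of_pos (by positivity : 0 < 2 * x)] at h5
      nlinarith [abs_nonneg (iteratedDeriv 1 sincSqrt x)]
    | j + 2 =>
      obtain ⟨C₁, h1⟩ := ih (j + 1) (by omega)
      obtain ⟨C₀, h2⟩ := ih j (by omega)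
      refine ⟨(4 * j + 6) * C₁ + C₀, fun x hx => ?_⟩
      have h3 := sincSqrt_ode j (x := x) (by linarith)
      have h4 : 4 * x * iteratedDeriv (j + 2) sincSqrt x =
          -((4 * j + 6) * iteratedDeriv (j + 1) sincSqrt x + iteratedDeriv j sincSqrt x) := by
        linarith
      have h5 : |4 * x * iteratedDeriv (j + 2) sincSqrt x| ≤ (4 * j + 6) * C₁ + C₀ := by
        rw [h4, abs_neg]
        refine (abs_add_le _ _).trans ?_
        rw [abs_mul, abs_of_pos (by positivity : (0 : ℝ) < 4 * j + 6)]
        have := h1 x hx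
        have := h2 x hx
        gcongr
      rw [abs_mul, abs_of_pos (by positivity : 0 < 4 * x)] at h5
      nlinarith [abs_nonneg (iteratedDeriv (j + 2) sincSqrt x)]

/-- A smooth function with bounded derivatives that agrees with `sin √x / √x` for `x ≥ 0`. -/
def kern (x : ℝ) : ℝ := Real.smoothTransition (x + 2) * sincSqrt x

theorem kern_contDiff {n : ℕ∞} : ContDiff ℝ n kern :=
  (Real.smoothTransition.contDiff.comp (contDiff_id.add contDiff_const)).mul sincSqrt_contDiff

theorem kern_eq {x : ℝ} (hx : -1 ≤ x) : kern x = sincSqrt x := by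
  rw [kern, Real.smoothTransition.one_of_one_le (by linarith), one_mul]

theorem mul_kern_sq (x : ℝ) : x * kern (x ^ 2) = Real.sin x := by
  rw [kern_eq (by nlinarith), mul_sincSqrt_sq]

theorem hasDerivAt_iteratedDeriv_kern (j : ℕ) (x : ℝ) :
    HasDerivAt (iteratedDeriv j kern) (iteratedDeriv (j + 1) kern x) x := by
  rw [iteratedDeriv_succ]
  exact ((kern_contDiff (n := ⊤)).differentiable_iteratedDeriv j
    (mod_cast WithTop.coe_lt_top _) x).hasDerivAt

theorem continuous_iteratedDeriv_kern (j : ℕ) : Continuous (iteratedDeriv j kern) :=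
  (kern_contDiff (n := j)).continuous_iteratedDeriv j le_rfl

/-- On the negative axis `sin √x / √x` grows like a hyperbolic sine, which is why `kern` is cut off.
What remains is a compact interval and the half-line `x ≥ 1`. -/
theorem exists_bound_iteratedDeriv_kern (j : ℕ) :
    ∃ C, 0 ≤ C ∧ ∀ x, |iteratedDeriv j kern x| ≤ C := by
  obtain ⟨C₁, h1⟩ := exists_bound_iteratedDeriv_sincSqrt j
  obtain ⟨C₂, h2⟩ := (isCompact_Icc (a := (-3 : ℝ)) (b := 1)).exists_bound_of_continuousOn
    (continuous_iteratedDeriv_kern j).continuousOn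
  have hC₂ : 0 ≤ C₂ := (norm_nonneg _).trans (h2 0 (by norm_num))
  refine ⟨max C₁ C₂, le_max_of_le_right hC₂, fun x => ?_⟩
  rcases lt_or_ge x (-3) with hx | hx
  · have : kern =ᶠ[𝓝 x] fun _ => 0 := by
      filter_upwards [gt_mem_nhds hx] with y hy
      rw [kern, Real.smoothTransition.zero_of_nonpos (by linarith), zero_mul]
    rw [(this.iteratedDeriv j).eq_of_nhds, iteratedDeriv_const]
    split <;> simpa using Or.inr hC₂
  · rcases le_or_gt x 1 with hx' | hx'
    · exact (h2 x ⟨hx, hx'⟩).trans (le_max_right _ _)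
    · have : kern =ᶠ[𝓝 x] sincSqrt := by
        filter_upwards [lt_mem_nhds hx'] with y hy using kern_eq (by linarith)
      rw [(this.iteratedDeriv j).eq_of_nhds]
      exact (h1 x hx'.le).trans (le_max_left _ _)

/-! ### A criterion for families of operators to map into the Schwartz space. -/

section Criterion

variable {D : Type*} [NormedAddCommGroup D] [NormedSpace ℝ D]

section

variable {X : Type*}

/-- Domination of a functional on the Schwartz space by a continuous seminorm, uniformly in a
parameter. -/
def SeminormBounded (N : 𝓢(D, ℂ) → X → ℝ) : Prop :=
  ∃ (s : Finset (ℕ × ℕ)) (C : ℝ), 0 ≤ C ∧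
    ∀ u x, N u x ≤ C * (s.sup (schwartzSeminormFamily ℂ D ℂ)) u

theorem SeminormBounded.mono {N N' : 𝓢(D, ℂ) → X → ℝ} (h : SeminormBounded N)
    (h' : ∀ u x, N' u x ≤ N u x) : SeminormBounded N' := by
  obtain ⟨s, C, hC, H⟩ := h
  exact ⟨s, C, hC, fun u x => (h' u x).trans (H u x)⟩

theorem SeminormBounded.add {N N' : 𝓢(D, ℂ) → X → ℝ} (h : SeminormBounded N)
    (h' : SeminormBounded N') : SeminormBounded fun u x => N u x + N' u x := by
  classical
  obtain ⟨s, C, hC, H⟩ := h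
  obtain ⟨s', C', hC', H'⟩ := h'
  refine ⟨s ∪ s', C + C', by positivity, fun u x => ?_⟩
  rw [add_mul]
  have h1 : (s.sup (schwartzSeminormFamily ℂ D ℂ)) u ≤
      ((s ∪ s').sup (schwartzSeminormFamily ℂ D ℂ)) u :=
    Finset.sup_mono (f := schwartzSeminormFamily ℂ D ℂ) Finset.subset_union_left u
  have h2 : (s'.sup (schwartzSeminormFamily ℂ D ℂ)) u ≤
      ((s ∪ s').sup (schwartzSeminormFamily ℂ D ℂ)) u :=
    Finset.sup_mono (f := schwartzSeminormFamily ℂ D ℂ) Finset.subset_union_right u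
  exact add_le_add ((H u x).trans (by gcongr)) ((H' u x).trans (by gcongr))

theorem SeminormBounded.sum {ι : Type*} (t : Finset ι) {N : ι → 𝓢(D, ℂ) → X → ℝ}
    (h : ∀ i, SeminormBounded (N i)) : SeminormBounded fun u x => ∑ i ∈ t, N i u x := by
  classical
  induction t using Finset.induction_on with
  | empty => exact ⟨∅, 0, le_rfl, fun u x => by simp⟩
  | insert a t ha ih =>
    exact ((h a).add ih).mono fun u x => by rw [Finset.sum_insert ha]

end

variable {E : Type*} [NormedAddCommGroup E] [InnerProductSpace ℝ E] [FiniteDimensional ℝ E]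

variable {P : (𝓢(D, ℂ) → E → ℂ) → Prop}

theorem contDiff_of_class
    (hdiff : ∀ A, P A → ∀ u, Differentiable ℝ (A u))
    (hderiv : ∀ A, P A → ∀ e : E, ∃ B, P B ∧ ∀ u x, fderiv ℝ (A u) x e = B u x)
    {A : 𝓢(D, ℂ) → E → ℂ} (hA : P A) (u : 𝓢(D, ℂ)) : ContDiff ℝ ∞ (A u) := by
  rw [contDiff_infty]
  intro n
  induction n generalizing A with
  | zero => exact contDiff_zero.2 (hdiff A hA u).continuous
  | succ n ih =>
    push_cast
    refine contDiff_succ_iff_fderiv_apply.2 ⟨hdiff A hA u, by simp, fun e => ?_⟩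
    obtain ⟨B, hB, h⟩ := hderiv A hA e
    simpa only [h] using ih hB

theorem norm_le_sum_abs_inner (x : E) :
    ‖x‖ ≤ ∑ i, |inner ℝ x (stdOrthonormalBasis ℝ E i)| := by
  conv_lhs => rw [← (stdOrthonormalBasis ℝ E).sum_repr' x]
  refine (norm_sum_le _ _).trans (Finset.sum_le_sum fun i _ => ?_)
  rw [norm_smul, (stdOrthonormalBasis ℝ E).norm_eq_one, mul_one, real_inner_comm, Real.norm_eq_abs]

theorem norm_iteratedFDeriv_succ_le_sum {f : E → ℂ} (hf : ContDiff ℝ ∞ f) (n : ℕ) (x : E) :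
    ‖iteratedFDeriv ℝ (n + 1) f x‖ ≤ ∑ i, ‖iteratedFDeriv ℝ n
      (fun y => fderiv ℝ f y (stdOrthonormalBasis ℝ E i)) x‖ := by
  set b := stdOrthonormalBasis ℝ E
  have hfi : ∀ i, ContDiff ℝ ∞ fun y => fderiv ℝ f y (b i) := fun i =>
    (hf.fderiv_right (m := ∞) (by simp)).clm_apply contDiff_const
  let L : ∀ i, ℂ →L[ℝ] (E →L[ℝ] ℂ) := fun i =>
    ContinuousLinearMap.smulRightL ℝ E ℂ (innerSL ℝ (b i))
  have hL : ∀ i, ‖L i‖ ≤ 1 := fun i => by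
    refine ContinuousLinearMap.opNorm_le_bound _ zero_le_one fun z => ?_
    simp [L, b]
  have h : fderiv ℝ f = fun y => ∑ i, L i (fderiv ℝ f y (b i)) := by
    funext y
    ext z
    conv_lhs => rw [← b.sum_repr' z]
    simp [L]
  rw [← norm_iteratedFDeriv_fderiv]
  conv_lhs => rw [h]
  rw [iteratedFDeriv_sum (f := fun i y => L i (fderiv ℝ f y (b i)))
    fun i _ => ((L i).contDiff.comp (hfi i)).of_le (mod_cast le_top), Finset.sum_apply]
  refine (norm_sum_le _ _).trans (Finset.sum_le_sum fun i _ => ?_)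
  refine ((L i).norm_iteratedFDeriv_comp_left (hfi i).contDiffAt (N := ∞) (n := n)
    (mod_cast le_top)).trans ?_
  exact mul_le_of_le_one_left (norm_nonneg _) (hL i)

/-- Every Schwartz seminorm reduces to sup bounds: each derivative is traded for directional
derivatives along an orthonormal basis, each factor `‖x‖` for coordinate factors, and the class
absorbs both. -/
theorem seminormBounded_of_class
    (hbound : ∀ A, P A → SeminormBounded fun u x => ‖A u x‖)
    (hdiff : ∀ A, P A → ∀ u, Differentiable ℝ (A u))
    (hderiv : ∀ A, P A → ∀ e : E, ∃ B, P B ∧ ∀ u x, fderiv ℝ (A u) x e = B u x)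
    (hmul : ∀ A, P A → ∀ e : E, ∃ B, P B ∧ ∀ u x, (inner ℝ x e : ℝ) * A u x = B u x)
    {A : 𝓢(D, ℂ) → E → ℂ} (hA : P A) (k n : ℕ) :
    SeminormBounded fun u x => ‖x‖ ^ k * ‖iteratedFDeriv ℝ n (A u) x‖ := by
  set b := stdOrthonormalBasis ℝ E
  induction n generalizing A with
  | zero =>
    simp only [norm_iteratedFDeriv_zero]
    induction k generalizing A with
    | zero => simpa using hbound A hA
    | succ k ih =>
      choose B hB h using fun i => hmul A hA (b i)
      refine (SeminormBounded.sum Finset.univ fun i => ih (hB i)).mono fun u x => ?_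
      calc ‖x‖ ^ (k + 1) * ‖A u x‖ = ‖x‖ ^ k * (‖x‖ * ‖A u x‖) := by ring
        _ ≤ ‖x‖ ^ k * ((∑ i, |inner ℝ x (b i)|) * ‖A u x‖) := by
          gcongr; exact norm_le_sum_abs_inner x
        _ = _ := by
          rw [Finset.sum_mul, Finset.mul_sum]
          refine Finset.sum_congr rfl fun i _ => ?_
          rw [← h i, norm_mul, Complex.norm_real, Real.norm_eq_abs]
  | succ n ih =>
    choose B hB h using fun i => hderiv A hA (b i)
    refine (SeminormBounded.sum Finset.univ fun i => ih (hB i)).mono fun u x => ?_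
    rw [← Finset.mul_sum]
    gcongr
    refine (norm_iteratedFDeriv_succ_le_sum (contDiff_of_class hdiff hderiv hA u) n x).trans_eq ?_
    refine Finset.sum_congr rfl fun i _ => ?_
    congr 2
    funext y
    exact h i u y

end Criterion

/-! ### Coordinates of `ℝ × ℝ²` and the integral operators with kernel `S⁽ʲ⁾(s y²) y²ʲ⁺¹ exp(i
σ·ζ)`. -/

/-- The first coordinate. -/
abbrev fstC : Space →L[ℝ] ℝ := WithLp.fstL 2 ℝ ℝ Plane

/-- The planar coordinate. -/
abbrev sndC : Space →L[ℝ] Plane := WithLp.sndL 2 ℝ ℝ Plane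

theorem pt_fst (a : ℝ) (v : Plane) : (pt a v).fst = a := rfl

theorem pt_snd (a : ℝ) (v : Plane) : (pt a v).snd = v := rfl

theorem pt_fst_snd (x : Space) : pt x.fst x.snd = x := rfl

theorem inner_space (x y : Space) :
    (inner ℝ x y : ℝ) = x.fst * y.fst + inner ℝ x.snd y.snd := by
  rw [WithLp.prod_inner_apply]
  simp [mul_comm]

theorem norm_sq_space (x : Space) : ‖x‖ ^ 2 = x.fst ^ 2 + ‖x.snd‖ ^ 2 := by
  rw [WithLp.prod_norm_sq_eq_of_L2, Real.norm_eq_abs, sq_abs]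

theorem abs_fst_le (x : Space) : |x.fst| ≤ ‖x‖ :=
  abs_le_of_sq_le_sq (by rw [norm_sq_space]; nlinarith [sq_nonneg ‖x.snd‖]) (norm_nonneg x)

theorem norm_snd_le (x : Space) : ‖x.snd‖ ≤ ‖x‖ :=
  le_of_sq_le_sq (by rw [norm_sq_space]; nlinarith [sq_nonneg x.fst]) (norm_nonneg x)

@[fun_prop]
theorem continuous_fst : Continuous fun x : Space => x.fst := fstC.continuous

@[fun_prop]
theorem continuous_snd : Continuous fun x : Space => x.snd := sndC.continuous

/-- The kernel `S⁽ʲ⁾(s y²) y²ʲ⁺¹ exp(i σ·ζ)` at `x = (s, σ)`, `w = (y, ζ)`. -/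
def sqrtKernel (j : ℕ) (x w : Space) : ℂ :=
  ((iteratedDeriv j kern (x.fst * w.fst ^ 2) * w.fst ^ (2 * j + 1) : ℝ) : ℂ) *
    Complex.exp (Complex.I * (inner ℝ x.snd w.snd : ℝ))

theorem norm_exp_I_mul (a : ℝ) : ‖Complex.exp (Complex.I * a)‖ = 1 := by
  rw [mul_comm, Complex.norm_exp_ofReal_mul_I]

theorem continuous_sqrtKernel (j : ℕ) : Continuous fun p : Space × Space => sqrtKernel j p.1 p.2 := by
  have := continuous_iteratedDeriv_kern j
  unfold sqrtKernel
  fun_prop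

theorem norm_sqrtKernel_le (j : ℕ) :
    ∃ C, 0 ≤ C ∧ ∀ x w, ‖sqrtKernel j x w‖ ≤ C * ‖w‖ ^ (2 * j + 1) := by
  obtain ⟨C, hC, h⟩ := exists_bound_iteratedDeriv_kern j
  refine ⟨C, hC, fun x w => ?_⟩
  rw [sqrtKernel, norm_mul, norm_exp_I_mul, mul_one, Complex.norm_real, norm_mul, norm_pow]
  gcongr
  · exact h _
  · exact abs_fst_le w

/-- The derivative of the kernel in its first argument. -/
def sqrtKernelDeriv (j : ℕ) (x w : Space) : Space →L[ℝ] ℂ :=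
  sqrtKernel (j + 1) x w • (Complex.ofRealCLM ∘L fstC) +
    (Complex.I * sqrtKernel j x w) • (Complex.ofRealCLM ∘L (innerSL ℝ w.snd ∘L sndC))

theorem hasFDerivAt_sqrtKernel (j : ℕ) (x w : Space) :
    HasFDerivAt (fun x => sqrtKernel j x w) (sqrtKernelDeriv j x w) x := by
  have h1 : HasFDerivAt (fun x : Space => x.fst * w.fst ^ 2) ((w.fst ^ 2) • fstC) x := by
    simpa using fstC.hasFDerivAt (x := x) |>.mul_const (w.fst ^ 2)
  have h2 := ((hasDerivAt_iteratedDeriv_kern j _).comp_hasFDerivAt x h1).mul_const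
    (w.fst ^ (2 * j + 1))
  have h3 := Complex.ofRealCLM.hasFDerivAt.comp x h2
  have h4 : HasFDerivAt (fun x : Space => (inner ℝ x.snd w.snd : ℝ))
      (innerSL ℝ w.snd ∘L sndC) x := by
    have := (innerSL ℝ w.snd ∘L sndC).hasFDerivAt (x := x)
    refine this.congr_of_eventuallyEq (Eventually.of_forall fun y => ?_)
    simp [real_inner_comm]
  have h5 := ((Complex.ofRealCLM.hasFDerivAt.comp x h4).const_mul Complex.I).cexp
  refine (h3.mul h5).congr_fderiv ?_
  ext e
  simp [sqrtKernelDeriv, sqrtKernel]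
  ring

theorem norm_sqrtKernelDeriv_le (j : ℕ) :
    ∃ C, 0 ≤ C ∧ ∀ x w, ‖sqrtKernelDeriv j x w‖ ≤
      C * (‖w‖ ^ (2 * (j + 1) + 1) + ‖w‖ ^ (2 * j + 2)) := by
  obtain ⟨C₁, hC₁, h₁⟩ := norm_sqrtKernel_le (j + 1)
  obtain ⟨C₂, hC₂, h₂⟩ := norm_sqrtKernel_le j
  refine ⟨max C₁ C₂, by positivity, fun x w => ?_⟩
  have hw : ‖innerSL ℝ w.snd ∘L sndC‖ ≤ ‖w‖ := by
    refine ContinuousLinearMap.opNorm_le_bound _ (norm_nonneg _) fun e => ?_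
    exact (norm_inner_le_norm (𝕜 := ℝ) _ _).trans (mul_le_mul (norm_snd_le w) (norm_snd_le e)
      (norm_nonneg _) (norm_nonneg _))
  have hf : ‖fstC‖ ≤ 1 := ContinuousLinearMap.opNorm_le_bound _ zero_le_one fun e => by
    rw [one_mul]; exact abs_fst_le e
  have ho : ‖Complex.ofRealCLM‖ = 1 := Complex.ofRealCLM_norm
  calc ‖sqrtKernelDeriv j x w‖ ≤ ‖sqrtKernel (j + 1) x w‖ * (1 * 1)
        + ‖sqrtKernel j x w‖ * (1 * ‖w‖) := by
        refine (norm_add_le _ _).trans ?_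
        rw [norm_smul, norm_smul, norm_mul, Complex.norm_I, one_mul]
        gcongr
        · exact (ContinuousLinearMap.opNorm_comp_le _ _).trans (by rw [ho]; gcongr)
        · exact (ContinuousLinearMap.opNorm_comp_le _ _).trans (by rw [ho]; gcongr)
    _ ≤ max C₁ C₂ * ‖w‖ ^ (2 * (j + 1) + 1) * (1 * 1)
        + max C₁ C₂ * ‖w‖ ^ (2 * j + 1) * (1 * ‖w‖) := by
        gcongr
        · exact (h₁ x w).trans (by gcongr; exact le_max_left _ _)
        · exact (h₂ x w).trans (by gcongr; exact le_max_right _ _)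
    _ = _ := by ring

theorem integrable_mul_schwartz {k : Space → ℂ} (hk : Continuous k) {C : ℝ} {n : ℕ}
    (hb : ∀ w, ‖k w‖ ≤ C * ‖w‖ ^ n) (v : 𝓢(Space, ℂ)) : Integrable fun w => k w * v w := by
  refine ((v.integrable_pow_mul volume n).const_mul C).mono'
    (by have := v.continuous; fun_prop) (Eventually.of_forall fun w => ?_)
  rw [norm_mul, ← mul_assoc]
  gcongr
  exact hb w

theorem integral_mul_lineDeriv {k k' : Space → ℂ} (hk : Continuous k) (hk' : Continuous k')
    {C C' : ℝ} {n n' : ℕ} (hb : ∀ w, ‖k w‖ ≤ C * ‖w‖ ^ n) (hb' : ∀ w, ‖k' w‖ ≤ C' * ‖w‖ ^ n')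
    {e : Space} (hd : ∀ w, HasLineDerivAt ℝ k (k' w) w e) (v : 𝓢(Space, ℂ)) :
    ∫ w, k w * LineDeriv.lineDerivOpCLM ℂ 𝓢(Space, ℂ) e v w = -∫ w, k' w * v w := by
  refine integral_bilinear_hasLineDerivAt_right_eq_neg_left_of_integrable
    (B := ContinuousLinearMap.mul ℝ ℂ) (v := e) (integrable_mul_schwartz hk' hb' v)
    (integrable_mul_schwartz hk hb _) (integrable_mul_schwartz hk hb v)
    (fun w _ => hd w) fun w _ => ?_
  have h : LineDeriv.lineDerivOpCLM ℂ 𝓢(Space, ℂ) e v w = fderiv ℝ v w e :=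
    SchwartzMap.lineDerivOp_apply_eq_fderiv e v w
  rw [h]
  exact (v.hasFDerivAt w).hasLineDerivAt e

/-- The integral operator `v ↦ ∫ S⁽ʲ⁾(s y²) y²ʲ⁺¹ v(y, ζ) exp(i σ·ζ) dy dζ`. -/
def sqrtIntegral (j : ℕ) (v : 𝓢(Space, ℂ)) (x : Space) : ℂ := ∫ w, sqrtKernel j x w * v w

theorem continuous_sqrtKernel_right (j : ℕ) (x : Space) : Continuous (sqrtKernel j x) :=
  (continuous_sqrtKernel j).comp (Continuous.prodMk_right x)

theorem integrable_sqrtKernel (j : ℕ) (x : Space) (v : 𝓢(Space, ℂ)) :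
    Integrable fun w => sqrtKernel j x w * v w := by
  obtain ⟨C, _, h⟩ := norm_sqrtKernel_le j
  exact integrable_mul_schwartz (continuous_sqrtKernel_right j x) (h x) v

theorem sqrtIntegral_add (j : ℕ) (u v : 𝓢(Space, ℂ)) (x : Space) :
    sqrtIntegral j (u + v) x = sqrtIntegral j u x + sqrtIntegral j v x := by
  unfold sqrtIntegral
  rw [← integral_add (integrable_sqrtKernel j x u) (integrable_sqrtKernel j x v)]
  simp only [add_apply, mul_add]

theorem sqrtIntegral_smul (j : ℕ) (c : ℂ) (v : 𝓢(Space, ℂ)) (x : Space) :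
    sqrtIntegral j (c • v) x = c * sqrtIntegral j v x := by
  unfold sqrtIntegral
  rw [← integral_const_mul]
  simp only [smul_apply, smul_eq_mul]
  exact integral_congr_ae (Eventually.of_forall fun w => by ring)

theorem seminormBounded_sqrtIntegral (j : ℕ) :
    SeminormBounded fun v (x : Space) => ‖sqrtIntegral j v x‖ := by
  obtain ⟨C, hC, h⟩ := norm_sqrtKernel_le j
  set K : ℝ := 2 ^ (volume : Measure Space).integrablePower *
    ∫ x : Space, (1 + ‖x‖) ^ (-((volume : Measure Space).integrablePower : ℝ))
  have hK : 0 ≤ K := by positivity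
  set p := (volume : Measure Space).integrablePower
  have h0 : SeminormBounded fun (v : 𝓢(Space, ℂ)) (_ : Space) =>
      C * K * (SchwartzMap.seminorm ℂ 0 0 v) := ⟨{(0, 0)}, C * K, by positivity, fun v x => by simp⟩
  have h1 : SeminormBounded fun (v : 𝓢(Space, ℂ)) (_ : Space) =>
      C * K * (SchwartzMap.seminorm ℂ (2 * j + 1 + p) 0 v) :=
    ⟨{(2 * j + 1 + p, 0)}, C * K, by positivity, fun v x => by simp⟩
  refine (h0.add h1).mono fun v x => ?_
  have h2 := SchwartzMap.integral_pow_mul_iteratedFDeriv_le ℂ volume v (2 * j + 1) 0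
  simp only [norm_iteratedFDeriv_zero] at h2
  calc ‖sqrtIntegral j v x‖ ≤ ∫ w, C * (‖w‖ ^ (2 * j + 1) * ‖v w‖) := by
        refine norm_integral_le_of_norm_le ((v.integrable_pow_mul volume _).const_mul C)
          (Eventually.of_forall fun w => ?_)
        rw [norm_mul, ← mul_assoc]
        gcongr
        exact h x w
    _ = C * ∫ w, ‖w‖ ^ (2 * j + 1) * ‖v w‖ := integral_const_mul _ _
    _ ≤ C * (K * (SchwartzMap.seminorm ℂ 0 0 v +
          SchwartzMap.seminorm ℂ (2 * j + 1 + p) 0 v)) := by gcongr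
    _ = _ := by ring

/-- Multiplication by `i ⟪ζ, e⟫`. -/
def mulInnerSnd (e : Plane) : 𝓢(Space, ℂ) →L[ℂ] 𝓢(Space, ℂ) :=
  Complex.I • SchwartzMap.smulLeftCLM ℂ fun w : Space => ((inner ℝ w.snd e : ℝ) : ℂ)

theorem mulInnerSnd_apply (e : Plane) (v : 𝓢(Space, ℂ)) (w : Space) :
    mulInnerSnd e v w = Complex.I * (inner ℝ w.snd e : ℝ) * v w := by
  have : Function.HasTemperateGrowth fun w : Space => ((inner ℝ w.snd e : ℝ) : ℂ) :=
    (Complex.ofRealCLM ∘L ((innerSL ℝ).flip e) ∘L sndC).hasTemperateGrowth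
  simp [mulInnerSnd, SchwartzMap.smulLeftCLM_apply_apply this, mul_assoc]

theorem hasFDerivAt_sqrtIntegral (j : ℕ) (v : 𝓢(Space, ℂ)) (x : Space) :
    HasFDerivAt (sqrtIntegral j v) (∫ w, v w • sqrtKernelDeriv j x w) x := by
  obtain ⟨C, hC, h⟩ := norm_sqrtKernelDeriv_le j
  have hc : ∀ x, Continuous fun w => v w • sqrtKernelDeriv j x w := by
    intro x
    have h1 := continuous_sqrtKernel_right j x
    have h2 := continuous_sqrtKernel_right (j + 1) x
    have h3 := v.continuous
    unfold sqrtKernelDeriv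
    have h4 : Continuous fun w : Space => Complex.ofRealCLM ∘L (innerSL ℝ w.snd ∘L sndC) := by
      fun_prop
    fun_prop
  refine hasFDerivAt_integral_of_dominated_of_fderiv_le (s := Set.univ)
    (F' := fun x w => v w • sqrtKernelDeriv j x w)
    (bound := fun w => C * (‖w‖ ^ (2 * (j + 1) + 1) * ‖v w‖ + ‖w‖ ^ (2 * j + 2) * ‖v w‖))
    univ_mem (Eventually.of_forall fun x => (integrable_sqrtKernel j x v).aestronglyMeasurable)
    (integrable_sqrtKernel j x v) (hc x).aestronglyMeasurable
    (Eventually.of_forall fun w x _ => ?_)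
    (((v.integrable_pow_mul volume _).add (v.integrable_pow_mul volume _)).const_mul C)
    (Eventually.of_forall fun w x _ => ?_)
  · rw [norm_smul]
    calc ‖v w‖ * ‖sqrtKernelDeriv j x w‖ ≤ ‖v w‖ * _ :=
        mul_le_mul_of_nonneg_left (h x w) (norm_nonneg _)
      _ = _ := by ring
  · exact (hasFDerivAt_sqrtKernel j x w).mul_const (v w)

/-- A derivative in `s` raises `j` by one; a derivative in `σ` multiplies `v` by a linear function
of `ζ`. -/
theorem fderiv_sqrtIntegral (j : ℕ) (v : 𝓢(Space, ℂ)) (x e : Space) :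
    fderiv ℝ (sqrtIntegral j v) x e =
      e.fst * sqrtIntegral (j + 1) v x + sqrtIntegral j (mulInnerSnd e.snd v) x := by
  obtain ⟨C, hC, h⟩ := norm_sqrtKernelDeriv_le j
  have hi : Integrable fun w => v w • sqrtKernelDeriv j x w := by
    have h1 := continuous_sqrtKernel_right j x
    have h2 := continuous_sqrtKernel_right (j + 1) x
    have h3 := v.continuous
    have h4 : Continuous fun w : Space => Complex.ofRealCLM ∘L (innerSL ℝ w.snd ∘L sndC) := by
      fun_prop
    refine Integrable.mono' (((v.integrable_pow_mul volume (2 * (j + 1) + 1)).add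
      (v.integrable_pow_mul volume (2 * j + 2))).const_mul C) ?_
      (Eventually.of_forall fun w => ?_)
    · unfold sqrtKernelDeriv
      exact Continuous.aestronglyMeasurable (by fun_prop)
    rw [norm_smul]
    calc ‖v w‖ * ‖sqrtKernelDeriv j x w‖ ≤ ‖v w‖ * _ :=
        mul_le_mul_of_nonneg_left (h x w) (norm_nonneg _)
      _ = _ := by simp only [Pi.add_apply]; ring
  rw [(hasFDerivAt_sqrtIntegral j v x).fderiv, ContinuousLinearMap.integral_apply hi]
  unfold sqrtIntegral
  rw [← integral_const_mul, ← integral_add ((integrable_sqrtKernel _ x v).const_mul _)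
    (integrable_sqrtKernel _ x _)]
  refine integral_congr_ae (Eventually.of_forall fun w => ?_)
  simp [sqrtKernelDeriv, mulInnerSnd_apply]
  ring

theorem differentiable_sqrtIntegral (j : ℕ) (v : 𝓢(Space, ℂ)) :
    Differentiable ℝ (sqrtIntegral j v) :=
  fun x => (hasFDerivAt_sqrtIntegral j v x).differentiableAt

/-- The derivative in the direction `e`. -/
abbrev dirDeriv (e : Space) : 𝓢(Space, ℂ) →L[ℂ] 𝓢(Space, ℂ) :=
  LineDeriv.lineDerivOpCLM ℂ 𝓢(Space, ℂ) e

/-- Integration by parts in `ζ`, which the kernel contains only through `exp(i σ·ζ)`. -/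
theorem inner_snd_mul_sqrtIntegral (j : ℕ) (e : Plane) (v : 𝓢(Space, ℂ)) (x : Space) :
    (inner ℝ x.snd e : ℝ) * sqrtIntegral j v x =
      sqrtIntegral j (Complex.I • dirDeriv (pt 0 e) v) x := by
  obtain ⟨C, hC, h⟩ := norm_sqrtKernel_le j
  have hd : ∀ w, HasLineDerivAt ℝ (sqrtKernel j x)
      (Complex.I * (inner ℝ x.snd e : ℝ) * sqrtKernel j x w) w (pt 0 e) := by
    intro w
    have h1 : (fun t : ℝ => sqrtKernel j x (w + t • pt 0 e)) = fun t : ℝ =>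
        sqrtKernel j x w * Complex.exp (Complex.I * (inner ℝ x.snd e : ℝ) * t) := by
      funext t
      have h2 : (w + t • pt 0 e).fst = w.fst := by simp [pt]
      have h3 : (w + t • pt 0 e).snd = w.snd + t • e := by simp [pt]
      rw [sqrtKernel, sqrtKernel, h2, h3, mul_assoc, ← Complex.exp_add, inner_add_right,
        inner_smul_right]
      push_cast
      congr 3
      ring
    rw [HasLineDerivAt, h1]
    have h2 : HasDerivAt (fun t : ℝ => Complex.I * (inner ℝ x.snd e : ℝ) * (t : ℂ))
        (Complex.I * (inner ℝ x.snd e : ℝ)) 0 := by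
      simpa using (Complex.ofRealCLM.hasDerivAt (x := 0)).const_mul
        (Complex.I * (inner ℝ x.snd e : ℝ))
    convert! (h2.cexp).const_mul (sqrtKernel j x w) using 1
    simp
    ring
  have hc := continuous_sqrtKernel_right j x
  have := integral_mul_lineDeriv hc (by fun_prop) (h x) (n' := 2 * j + 1)
    (C' := |inner ℝ x.snd e| * C) (fun w => ?_) hd v
  · rw [sqrtIntegral_smul]
    unfold sqrtIntegral
    rw [this, ← integral_neg, ← integral_const_mul, ← integral_const_mul]
    refine integral_congr_ae (Eventually.of_forall fun w => ?_)
    linear_combination ((inner ℝ x.snd e : ℝ) * sqrtKernel j x w * v w) * Complex.I_sq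
  · rw [norm_mul, norm_mul, Complex.norm_I, one_mul, Complex.norm_real, Real.norm_eq_abs, mul_assoc]
    gcongr
    exact h x w

/-- For `s = r² > 0` the kernel is `sin(r y) / r` times a phase independent of `y`, so `∂_y²`
multiplies it by `-s`. Two integrations by parts move `∂_y²` onto `v`; this is the source of decay
as `s → ∞`. -/
theorem fst_mul_sqrtIntegral_zero {x : Space} (hx : 0 < x.fst) (v : 𝓢(Space, ℂ)) :
    x.fst * sqrtIntegral 0 v x =
      -sqrtIntegral 0 (dirDeriv (pt 1 0) (dirDeriv (pt 1 0) v)) x := by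
  obtain ⟨C, hC, h⟩ := norm_sqrtKernel_le 0
  set r := √x.fst
  have hr : r ^ 2 = x.fst := Real.sq_sqrt hx.le
  have hr0 : r ≠ 0 := (Real.sqrt_pos.2 hx).ne'
  let ph : Space → ℂ := fun w => Complex.exp (Complex.I * (inner ℝ x.snd w.snd : ℝ))
  have hph : Continuous ph := by fun_prop
  have hphn : ∀ w, ‖ph w‖ = 1 := fun w => norm_exp_I_mul _
  have hph' : ∀ (w : Space) (t : ℝ), ph (w + t • pt 1 0) = ph w := by
    intro w t
    have h3 : (w + t • pt 1 0).snd = w.snd := by simp [pt]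
    simp only [ph, h3]
  have hft : ∀ (w : Space) (t : ℝ), (w + t • pt 1 0).fst = w.fst + t := by
    intro w t; simp [pt]
  have hk : ∀ w, sqrtKernel 0 x w = ((Real.sin (r * w.fst) / r : ℝ) : ℂ) * ph w := by
    intro w
    rw [sqrtKernel, iteratedDeriv_zero, ← mul_kern_sq, ← hr]
    congr 2
    field_simp
    ring_nf
  have hin : ∀ (w : Space), HasDerivAt (fun t : ℝ => r * (w.fst + t)) r 0 := fun w => by
    simpa using ((hasDerivAt_id (0 : ℝ)).const_add w.fst).const_mul r
  have hd1 : ∀ w, HasLineDerivAt ℝ (sqrtKernel 0 x)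
      (((Real.cos (r * w.fst) : ℝ) : ℂ) * ph w) w (pt 1 0) := by
    intro w
    simp only [HasLineDerivAt, hk, hph', hft]
    have h1 := (((Real.hasDerivAt_sin _).comp 0 (hin w)).div_const r).ofReal_comp.mul_const (ph w)
    convert! h1 using 3
    simp [hr0]
  have hd2 : ∀ w, HasLineDerivAt ℝ (fun w : Space => ((Real.cos (r * w.fst) : ℝ) : ℂ) * ph w)
      (-x.fst * sqrtKernel 0 x w) w (pt 1 0) := by
    intro w
    simp only [HasLineDerivAt, hph', hft]
    have h1 := ((Real.hasDerivAt_cos _).comp 0 (hin w)).ofReal_comp.mul_const (ph w)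
    convert! h1 using 1
    rw [hk, ← hr]
    simp only [add_zero]
    push_cast
    have : (r : ℂ) ≠ 0 := by exact_mod_cast hr0
    field_simp
  have hc := continuous_sqrtKernel_right 0 x
  have hcosb : ∀ w : Space, ‖((Real.cos (r * w.fst) : ℝ) : ℂ) * ph w‖ ≤ 1 * ‖w‖ ^ 0 := fun w => by
    rw [norm_mul, hphn, Complex.norm_real, mul_one, pow_zero, mul_one]
    exact Real.abs_cos_le_one _
  have e1 := integral_mul_lineDeriv hc (by fun_prop) (h x) hcosb hd1 (dirDeriv (pt 1 0) v)
  have e2 := integral_mul_lineDeriv (by fun_prop) (by fun_prop) hcosb (n' := 2 * 0 + 1)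
    (C' := |x.fst| * C) (fun w => ?_) hd2 v
  · unfold sqrtIntegral
    rw [e1, e2, neg_neg, ← integral_neg, ← integral_const_mul]
    refine integral_congr_ae (Eventually.of_forall fun w => ?_)
    simp only
    ring
  · rw [norm_mul, norm_neg, Complex.norm_real, Real.norm_eq_abs, mul_assoc]
    gcongr
    exact h x w

theorem hasDerivAt_sqrtIntegral (j : ℕ) (v : 𝓢(Space, ℂ)) (s : ℝ) (σ : Plane) :
    HasDerivAt (fun t => sqrtIntegral j v (pt t σ)) (sqrtIntegral (j + 1) v (pt s σ)) s := by
  have h1 : HasDerivAt (fun t => pt t σ) (pt 1 0) s := by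
    have h2 : (fun t => pt t σ) = fun t : ℝ => t • pt 1 0 + pt 0 σ := by
      funext t; apply WithLp.ofLp_injective; simp [pt]
    rw [h2]
    simpa using ((hasDerivAt_id s).smul_const (pt 1 0)).add_const (pt 0 σ)
  have h := HasFDerivAt.comp_hasDerivAt (f := fun t => pt t σ) s
    (differentiable_sqrtIntegral j v (pt s σ)).hasFDerivAt h1
  rw [fderiv_sqrtIntegral] at h
  have h0 : sqrtIntegral j (mulInnerSnd (pt 1 0).snd v) (pt s σ) = 0 := by
    have : mulInnerSnd (pt 1 0).snd v = 0 := by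
      ext w; simp [mulInnerSnd_apply, pt]
    rw [this]; simp [sqrtIntegral]
  rw [h0] at h
  simpa [pt, Function.comp_def] using h

/-- The case `j = 0` differentiated `j` times in `s`; the last term comes from the product rule on
the factor `s`. -/
theorem fst_mul_sqrtIntegral (j : ℕ) {x : Space} (hx : 0 < x.fst) (v : 𝓢(Space, ℂ)) :
    x.fst * sqrtIntegral j v x =
      -sqrtIntegral j (dirDeriv (pt 1 0) (dirDeriv (pt 1 0) v)) x
        - j * sqrtIntegral (j - 1) v x := by
  induction j generalizing x with
  | zero => simpa using fst_mul_sqrtIntegral_zero hx v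
  | succ j ih =>
    obtain ⟨s, σ, rfl⟩ : ∃ s σ, x = pt s σ := ⟨x.fst, x.snd, rfl⟩
    rw [pt_fst] at hx ⊢
    have h1 := (Complex.ofRealCLM.hasDerivAt (x := s)).mul (hasDerivAt_sqrtIntegral j v s σ)
    have h2 := (hasDerivAt_sqrtIntegral j (dirDeriv (pt 1 0) (dirDeriv (pt 1 0) v)) s σ).neg.sub
      ((hasDerivAt_sqrtIntegral (j - 1) v s σ).const_mul (j : ℂ))
    have h3 := h2.congr_of_eventuallyEq 
      (f₁ := ⇑Complex.ofRealCLM * fun t => sqrtIntegral j v (pt t σ))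
      (by filter_upwards [lt_mem_nhds hx] with t ht
          simpa [pt_fst] using ih (x := pt t σ) ht)
    have h4 := h1.unique h3
    -- When `j = 0` the truncated index is wrong, but its coefficient is zero.
    have h5 : (j : ℂ) * sqrtIntegral (j - 1 + 1) v (pt s σ) = j * sqrtIntegral j v (pt s σ) := by
      rcases j with _ | j <;> simp
    rw [h5] at h4
    simp only [Complex.ofRealCLM_apply, Complex.ofReal_one, one_mul] at h4
    push_cast
    linear_combination h4

/-! ### The cut off operators form a class satisfying the criterion. -/

/-- A smooth function that is `1` on `[0, ∞)` and `0` on `(-∞, -1]`. -/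
def leftCutoff (s : ℝ) : ℝ := Real.smoothTransition (s + 1)

theorem leftCutoff_contDiff : ContDiff ℝ ∞ leftCutoff :=
  Real.smoothTransition.contDiff.comp (contDiff_id.add contDiff_const)

theorem leftCutoff_of_nonneg {s : ℝ} (hs : 0 ≤ s) : leftCutoff s = 1 :=
  Real.smoothTransition.one_of_one_le (by linarith)

theorem leftCutoff_of_le {s : ℝ} (hs : s ≤ -1) : leftCutoff s = 0 :=
  Real.smoothTransition.zero_of_nonpos (by linarith)

/-- The class of operators generated by the cut off integral operators `sqrtIntegral`. It is closed
under differentiation and under multiplication by linear functions. -/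
inductive SqrtClass : (𝓢(Space, ℂ) → Space → ℂ) → Prop
  | compact (η : ℝ → ℝ) (hη : ContDiff ℝ ∞ η) (hc : HasCompactSupport η) (j : ℕ)
      (L : 𝓢(Space, ℂ) →L[ℂ] 𝓢(Space, ℂ)) :
      SqrtClass fun u x => η x.fst * sqrtIntegral j (L u) x
  | main (j : ℕ) (L : 𝓢(Space, ℂ) →L[ℂ] 𝓢(Space, ℂ)) :
      SqrtClass fun u x => leftCutoff x.fst * sqrtIntegral j (L u) x
  | add (A B : 𝓢(Space, ℂ) → Space → ℂ) (hA : SqrtClass A) (hB : SqrtClass B) :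
      SqrtClass fun u x => A u x + B u x

theorem SeminormBounded.comp_clm {N : 𝓢(Space, ℂ) → Space → ℝ} (h : SeminormBounded N)
    (L : 𝓢(Space, ℂ) →L[ℂ] 𝓢(Space, ℂ)) : SeminormBounded fun u x => N (L u) x := by
  obtain ⟨s, C, hC, H⟩ := h
  obtain ⟨t, C', _, h'⟩ := Seminorm.bound_of_continuous (schwartz_withSeminorms ℂ Space ℂ)
    ((s.sup (schwartzSeminormFamily ℂ Space ℂ)).comp L.toLinearMap)
    ((Seminorm.continuous_finsetSup fun i _ => (schwartz_withSeminorms ℂ Space ℂ).continuous_seminorm i).comp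
      L.continuous)
  refine ⟨t, C * C', by positivity, fun u x => (H (L u) x).trans ?_⟩
  rw [mul_assoc]
  exact mul_le_mul_of_nonneg_left (h' u) hC

theorem SeminormBounded.const_mul {N : 𝓢(Space, ℂ) → Space → ℝ} (h : SeminormBounded N)
    {c : ℝ} (hc : 0 ≤ c) : SeminormBounded fun u x => c * N u x := by
  obtain ⟨s, C, hC, H⟩ := h
  exact ⟨s, c * C, by positivity, fun u x => by
    rw [mul_assoc]; exact mul_le_mul_of_nonneg_left (H u x) hc⟩

theorem SqrtClass.seminormBounded {A : 𝓢(Space, ℂ) → Space → ℂ} (hA : SqrtClass A) :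
    SeminormBounded fun u x => ‖A u x‖ := by
  induction hA with
  | compact η hη hc j L =>
    obtain ⟨C, hC⟩ := hc.exists_bound_of_continuous hη.continuous
    have hC0 : 0 ≤ C := (norm_nonneg _).trans (hC 0)
    refine (((seminormBounded_sqrtIntegral j).comp_clm L).const_mul hC0).mono fun u x => ?_
    rw [norm_mul, Complex.norm_real]
    gcongr
    exact hC _
  | main j L =>
    refine ((seminormBounded_sqrtIntegral j).comp_clm L).mono fun u x => ?_
    rw [norm_mul, Complex.norm_real, leftCutoff,
      Real.norm_of_nonneg (Real.smoothTransition.nonneg _)]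
    exact mul_le_of_le_one_left (norm_nonneg _) (Real.smoothTransition.le_one _)
  | add A B _ _ hA hB => exact (hA.add hB).mono fun u x => norm_add_le _ _

theorem hasFDerivAt_cutoff_mul {η : ℝ → ℝ} (hη : ContDiff ℝ ∞ η) (j : ℕ) (v : 𝓢(Space, ℂ))
    (x : Space) : HasFDerivAt (fun x : Space => (η x.fst : ℂ) * sqrtIntegral j v x)
      ((η x.fst : ℂ) • fderiv ℝ (sqrtIntegral j v) x +
        sqrtIntegral j v x • (Complex.ofRealCLM ∘L (deriv η x.fst • fstC))) x := by
  have h1 : HasFDerivAt (fun x : Space => η x.fst) (deriv η x.fst • fstC) x :=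
    ((hη.differentiable (by simp)) x.fst).hasDerivAt.comp_hasFDerivAt x fstC.hasFDerivAt
  exact (Complex.ofRealCLM.hasFDerivAt.comp x h1).mul
    (differentiable_sqrtIntegral j v x).hasFDerivAt

theorem fderiv_cutoff_mul {η : ℝ → ℝ} (hη : ContDiff ℝ ∞ η) (j : ℕ) (v : 𝓢(Space, ℂ))
    (x e : Space) : fderiv ℝ (fun x : Space => (η x.fst : ℂ) * sqrtIntegral j v x) x e =
      ((deriv η x.fst : ℝ) : ℂ) * sqrtIntegral j ((e.fst : ℂ) • v) x +
        ((η x.fst : ℂ) * sqrtIntegral (j + 1) ((e.fst : ℂ) • v) x +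
          (η x.fst : ℂ) * sqrtIntegral j (mulInnerSnd e.snd v) x) := by
  rw [(hasFDerivAt_cutoff_mul hη j v x).fderiv]
  simp only [add_apply, smul_apply, ContinuousLinearMap.comp_apply, fderiv_sqrtIntegral,
    smul_eq_mul, sqrtIntegral_smul, Complex.ofRealCLM_apply, WithLp.fstL_apply]
  push_cast
  ring

theorem SqrtClass.differentiable {A : 𝓢(Space, ℂ) → Space → ℂ} (hA : SqrtClass A)
    (u : 𝓢(Space, ℂ)) : Differentiable ℝ (A u) := by
  induction hA with
  | compact η hη hc j L => exact fun x => (hasFDerivAt_cutoff_mul hη j (L u) x).differentiableAt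
  | main j L =>
    exact fun x => (hasFDerivAt_cutoff_mul leftCutoff_contDiff j (L u) x).differentiableAt
  | add A B _ _ hA hB => exact hA.add hB

theorem contDiff_deriv_cutoff {η : ℝ → ℝ} (hη : ContDiff ℝ ∞ η) : ContDiff ℝ ∞ (deriv η) :=
  (contDiff_infty_iff_deriv.1 hη).2

theorem hasCompactSupport_deriv_leftCutoff : HasCompactSupport (deriv leftCutoff) := by
  refine HasCompactSupport.intro (isCompact_Icc (a := (-1 : ℝ)) (b := 0)) fun s hs => ?_
  rcases lt_or_ge s (-1) with h | h
  · have : leftCutoff =ᶠ[𝓝 s] fun _ => 0 := by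
      filter_upwards [gt_mem_nhds h] with y hy using leftCutoff_of_le hy.le
    rw [this.deriv_eq, deriv_const]
  · have h0 : 0 < s := by
      by_contra h0
      exact hs ⟨h, not_lt.1 h0⟩
    have : leftCutoff =ᶠ[𝓝 s] fun _ => 1 := by
      filter_upwards [lt_mem_nhds h0] with y hy using leftCutoff_of_nonneg hy.le
    rw [this.deriv_eq, deriv_const]

theorem SqrtClass.fderiv {A : 𝓢(Space, ℂ) → Space → ℂ} (hA : SqrtClass A) (e : Space) :
    ∃ B, SqrtClass B ∧ ∀ u x, fderiv ℝ (A u) x e = B u x := by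
  induction hA with
  | compact η hη hc j L =>
    exact ⟨_, .add _ _ (.compact (deriv η) (contDiff_deriv_cutoff hη) hc.deriv j ((e.fst : ℂ) • L))
      (.add _ _ (.compact η hη hc (j + 1) ((e.fst : ℂ) • L))
        (.compact η hη hc j (mulInnerSnd e.snd ∘L L))),
      fun u x => fderiv_cutoff_mul hη j (L u) x e⟩
  | main j L =>
    exact ⟨_, .add _ _ (.compact (deriv leftCutoff) (contDiff_deriv_cutoff leftCutoff_contDiff)
        hasCompactSupport_deriv_leftCutoff j ((e.fst : ℂ) • L))
      (.add _ _ (.main (j + 1) ((e.fst : ℂ) • L)) (.main j (mulInnerSnd e.snd ∘L L))),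
      fun u x => fderiv_cutoff_mul leftCutoff_contDiff j (L u) x e⟩
  | add A B hA hB ihA ihB =>
    obtain ⟨A', hA', h⟩ := ihA
    obtain ⟨B', hB', h'⟩ := ihB
    refine ⟨_, .add _ _ hA' hB', fun u x => ?_⟩
    rw [← h, ← h', fderiv_fun_add (hA.differentiable u x) (hB.differentiable u x)]
    rfl

/-- A compactly supported smooth function that agrees with `leftCutoff` on `(-∞, 0]`. -/
def innerCutoff (s : ℝ) : ℝ := leftCutoff s * (1 - Real.smoothTransition s)

theorem innerCutoff_contDiff : ContDiff ℝ ∞ innerCutoff :=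
  leftCutoff_contDiff.mul (contDiff_const.sub Real.smoothTransition.contDiff)

theorem hasCompactSupport_innerCutoff : HasCompactSupport innerCutoff := by
  refine HasCompactSupport.intro (isCompact_Icc (a := (-1 : ℝ)) (b := 1)) fun s hs => ?_
  rcases lt_or_ge s (-1) with h | h
  · rw [innerCutoff, leftCutoff_of_le h.le, zero_mul]
  · have h0 : 1 < s := by
      by_contra h0
      exact hs ⟨h, not_lt.1 h0⟩
    rw [innerCutoff, Real.smoothTransition.one_of_one_le h0.le, sub_self, mul_zero]

theorem SqrtClass.inner_mul {A : 𝓢(Space, ℂ) → Space → ℂ} (hA : SqrtClass A) (e : Space) :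
    ∃ B, SqrtClass B ∧ ∀ u x, (inner ℝ x e : ℝ) * A u x = B u x := by
  induction hA with
  | compact η hη hc j L =>
    refine ⟨_, .add _ _ (.compact (fun s => s * η s) (contDiff_id.mul hη) hc.mul_left j
      ((e.fst : ℂ) • L)) (.compact η hη hc j ((Complex.I • dirDeriv (pt 0 e.snd)) ∘L L)),
      fun u x => ?_⟩
    have := inner_snd_mul_sqrtIntegral j e.snd (L u) x
    simp only [ContinuousLinearMap.comp_apply, smul_apply]
    rw [← this, inner_space, sqrtIntegral_smul]
    push_cast
    ring
  | main j L =>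
    -- The identity for `s` times the integral is available only for `s > 0`. There the three
    -- `innerCutoff` terms add up to zero. For `s ≤ 0`, where `innerCutoff` equals `leftCutoff`,
    -- they cancel the `D` and `j - 1` terms and leave `s` times the original.
    set D := dirDeriv (pt 1 0) ∘L dirDeriv (pt 1 0)
    refine ⟨_, .add _ _ (.add _ _ (.add _ _ (.main j ((-e.fst : ℂ) • D ∘L L))
        (.main (j - 1) ((-e.fst * j : ℂ) • L)))
        (.add _ _ (.compact (fun s => s * innerCutoff s) (contDiff_id.mul innerCutoff_contDiff)
          hasCompactSupport_innerCutoff.mul_left j ((e.fst : ℂ) • L))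
        (.add _ _ (.compact innerCutoff innerCutoff_contDiff hasCompactSupport_innerCutoff j
          ((e.fst : ℂ) • D ∘L L)) (.compact innerCutoff innerCutoff_contDiff
          hasCompactSupport_innerCutoff (j - 1) ((e.fst * j : ℂ) • L)))))
        (.main j ((Complex.I • dirDeriv (pt 0 e.snd)) ∘L L)), fun u x => ?_⟩
    have h := inner_snd_mul_sqrtIntegral j e.snd (L u) x
    simp only [ContinuousLinearMap.comp_apply, smul_apply]
    rw [← h, inner_space]
    simp only [sqrtIntegral_smul]
    rcases le_or_gt x.fst 0 with hx | hx
    · rw [innerCutoff, Real.smoothTransition.zero_of_nonpos hx]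
      push_cast
      ring
    · have h2 := fst_mul_sqrtIntegral j hx (L u)
      have h3 : sqrtIntegral j (D (L u)) x =
          -(x.fst * sqrtIntegral j (L u) x) - j * sqrtIntegral (j - 1) (L u) x := by
        rw [h2]
        simp only [D, ContinuousLinearMap.comp_apply]
        ring
      rw [h3]
      push_cast
      ring
  | add A B hA hB ihA ihB =>
    obtain ⟨A', hA', h⟩ := ihA
    obtain ⟨B', hB', h'⟩ := ihB
    refine ⟨_, .add _ _ hA' hB', fun u x => ?_⟩
    rw [← h, ← h', mul_add]

/-- The map `v ↦ leftCutoff(s) ∫ S(s y²) y v(y, ζ) exp(i σ·ζ) dy dζ` on the Schwartz space. -/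
def sqrtSchwartz : 𝓢(Space, ℂ) →L[ℂ] 𝓢(Space, ℂ) :=
  have hA : SqrtClass fun u x => leftCutoff x.fst *
    sqrtIntegral 0 (ContinuousLinearMap.id ℂ 𝓢(Space, ℂ) u) x := .main 0 _
  mkCLM (fun v x => leftCutoff x.fst * sqrtIntegral 0 v x)
    (fun u v x => by rw [sqrtIntegral_add, mul_add])
    (fun c v x => by rw [sqrtIntegral_smul, RingHom.id_apply, smul_eq_mul]; ring)
    (fun v => contDiff_of_class (fun _ hA u => hA.differentiable u) (fun _ hA e => hA.fderiv e)
      hA v)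
    (fun n => seminormBounded_of_class (fun _ hA => hA.seminormBounded)
      (fun _ hA u => hA.differentiable u) (fun _ hA e => hA.fderiv e) (fun _ hA e => hA.inner_mul e)
      hA n.1 n.2)

theorem sqrtSchwartz_apply (v : 𝓢(Space, ℂ)) (x : Space) :
    sqrtSchwartz v x = leftCutoff x.fst * sqrtIntegral 0 v x := rfl

end Smooth

/-! ### Inversion and parity for the Fourier transform. -/

/-- The constant `(2π)^(-3/2)`. -/
def fourierConst : ℝ := (2 * Real.pi) ^ (-(3 / 2) : ℝ)

theorem fourierConst_pos : 0 < fourierConst := by unfold fourierConst; positivity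

theorem fourierConst_ne_zero : (fourierConst : ℂ) ≠ 0 := by
  exact_mod_cast fourierConst_pos.ne'

/-- The inverse of `fourierS`. -/
def fourierSInv : 𝓢(Space, ℂ) →L[ℂ] 𝓢(Space, ℂ) :=
  (fourierConst : ℂ)⁻¹ • ((fourierCLM ℂ 𝓢(Space, ℂ)).comp
    (compCLMOfContinuousLinearEquiv ℂ dilation.symm))

theorem fourierSInv_fourierS (u : 𝓢(Space, ℂ)) : fourierSInv (fourierS u) = u := by
  have h : compCLMOfContinuousLinearEquiv ℂ dilation.symm
      (compCLMOfContinuousLinearEquiv ℂ dilation (𝓕⁻ u)) = 𝓕⁻ u := by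
    ext x; simp
  simp only [fourierSInv, fourierS, smul_apply, ContinuousLinearMap.comp_apply, map_smul,
    fourierInvCLM_apply, fourierCLM_apply, h, fourier_fourierInv_eq]
  rw [smul_smul, ← fourierConst, mul_inv_cancel₀ fourierConst_ne_zero, one_smul]

theorem fourierS_fourierSInv (u : 𝓢(Space, ℂ)) : fourierS (fourierSInv u) = u := by
  simp only [fourierSInv, fourierS, smul_apply, ContinuousLinearMap.comp_apply, map_smul,
    fourierInvCLM_apply, fourierCLM_apply, fourierInv_fourier_eq]
  rw [smul_smul, ← fourierConst, inv_mul_cancel₀ fourierConst_ne_zero, one_smul]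
  ext x; simp

theorem finrank_space : Module.finrank ℝ Space = 3 := by
  rw [(WithLp.linearEquiv 2 ℝ (ℝ × Plane)).finrank_eq]
  simp

theorem fourierConst_sq : fourierConst ^ 2 = ((2 * Real.pi) ^ 3)⁻¹ := by
  have h : (0 : ℝ) < 2 * Real.pi := by positivity
  rw [fourierConst, ← Real.rpow_natCast, ← Real.rpow_mul h.le, ← Real.rpow_natCast,
    ← Real.rpow_neg h.le]
  norm_num

/-- With this normalisation the transform is unitary: the dilation by `2π` contributes `(2π)⁻³`, the
square of `fourierConst`. -/
theorem fourierSInv_apply (u : 𝓢(Space, ℂ)) (x : Space) : fourierSInv u x = fourierS u (-x) := by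
  have h1 : fourierSInv u x = (fourierConst : ℂ)⁻¹ *
      𝓕 (fun y : Space => u ((2 * Real.pi) • y)) x := by
    simp only [fourierSInv, smul_apply, ContinuousLinearMap.comp_apply, fourierCLM_apply,
      smul_eq_mul, SchwartzMap.fourier_coe]
    congr 1
    refine congrFun (congrArg 𝓕 (funext fun y => ?_)) x
    simp only [compCLMOfContinuousLinearEquiv_apply, Function.comp]
    congr 1
    rw [ContinuousLinearEquiv.symm_apply_eq, dilation_apply, smul_smul, inv_mul_cancel₀, one_smul]
    positivity
  have h2 : ∀ y : Space, Complex.exp ((↑(-2 * Real.pi * inner ℝ y x) : ℂ) * Complex.I) •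
      u ((2 * Real.pi) • y) = (fun z : Space => u z *
        Complex.exp (Complex.I * (inner ℝ (-x) z : ℝ))) ((2 * Real.pi) • y) := by
    intro y
    simp only [inner_smul_right, inner_neg_left, smul_eq_mul, real_inner_comm x y]
    rw [mul_comm]
    congr 2
    push_cast
    ring
  rw [h1, Real.fourier_eq', integral_congr_ae (Eventually.of_forall h2),
    Measure.integral_comp_smul volume (fun z : Space => u z *
      Complex.exp (Complex.I * (inner ℝ (-x) z : ℝ))), fourierS_apply, ← fourierConst, finrank_space,
    abs_of_pos (by positivity), ← fourierConst_sq, Complex.real_smul, ← mul_assoc]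
  congr 1
  push_cast
  field_simp [fourierConst_ne_zero]

/-- Composition with the reflection `(a, v) ↦ (-a, v)`. -/
def reflectCLM : 𝓢(Space, ℂ) →L[ℂ] 𝓢(Space, ℂ) :=
  compCLMOfContinuousLinearEquiv ℂ reflect.toContinuousLinearEquiv

theorem reflectCLM_apply (f : 𝓢(Space, ℂ)) (x : Space) : reflectCLM f x = f (reflect x) := rfl

theorem reflectCLM_reflectCLM (f : 𝓢(Space, ℂ)) : reflectCLM (reflectCLM f) = f := by
  ext x; rw [reflectCLM_apply, reflectCLM_apply, reflect_reflect]

theorem mem_SOdd_iff {f : 𝓢(Space, ℂ)} : f ∈ SOdd ↔ reflectCLM f = -f :=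
  ⟨fun h => by ext x; exact h x.fst x.snd, fun h a v => by
    rw [← reflect_pt, ← reflectCLM_apply, h]; rfl⟩

theorem mem_SEven_iff {f : 𝓢(Space, ℂ)} : f ∈ SEven ↔ reflectCLM f = f :=
  ⟨fun h => by ext x; exact h x.fst x.snd, fun h a v => by
    rw [← reflect_pt, ← reflectCLM_apply, h]⟩

theorem fourierS_reflectCLM (f : 𝓢(Space, ℂ)) :
    fourierS (reflectCLM f) = reflectCLM (fourierS f) := by
  ext η
  rw [reflectCLM_apply, fourierS_apply, fourierS_apply]
  congr 1
  rw [← (reflect.measurePreserving).integral_comp reflect.toHomeomorph.measurableEmbedding]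
  refine integral_congr_ae (Eventually.of_forall fun x => ?_)
  simp only [reflectCLM_apply, reflect_reflect]
  rw [← reflect.inner_map_map, reflect_reflect]

theorem fourierSInv_reflectCLM (f : 𝓢(Space, ℂ)) :
    fourierSInv (reflectCLM f) = reflectCLM (fourierSInv f) := by
  conv_lhs => rw [← fourierS_fourierSInv f, ← fourierS_reflectCLM, fourierSInv_fourierS]

theorem fourierS_mem_SOdd {f : 𝓢(Space, ℂ)} (hf : f ∈ SOdd) : fourierS f ∈ SOdd := by
  rw [mem_SOdd_iff] at hf ⊢
  rw [← fourierS_reflectCLM, hf, map_neg]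

theorem fourierSInv_mem_SOdd {f : 𝓢(Space, ℂ)} (hf : f ∈ SOdd) : fourierSInv f ∈ SOdd := by
  rw [mem_SOdd_iff] at hf ⊢
  rw [← fourierSInv_reflectCLM, hf, map_neg]

theorem fourierSInv_mem_SEven {f : 𝓢(Space, ℂ)} (hf : f ∈ SEven) : fourierSInv f ∈ SEven := by
  rw [mem_SEven_iff] at hf ⊢
  rw [← fourierSInv_reflectCLM, hf]

/-! ### The square-root substitution and the maps `E₂`, `E₁`, `E`. -/

/-- For odd `φ`, the function `sqrtQuot φ` extends `φ(√s, σ) / √s`, `s > 0`, to a Schwartz function,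
see `mul_sqrtQuot`. -/
def sqrtQuot : 𝓢(Space, ℂ) →L[ℂ] 𝓢(Space, ℂ) :=
  (Complex.I * fourierConst) • (sqrtSchwartz ∘L fourierSInv)

theorem fourierS_pt_of_odd {v : 𝓢(Space, ℂ)} (hv : v ∈ SOdd) (t : ℝ) (σ : Plane) :
    fourierS v (pt t σ) = Complex.I * fourierConst * ∫ w : Space, (Real.sin (t * w.fst) : ℂ) *
      Complex.exp (Complex.I * (inner ℝ σ w.snd : ℝ)) * v w := by
  have hint : ∀ a : ℝ, Integrable fun w : Space =>
      Complex.exp (Complex.I * (inner ℝ (pt a σ) w : ℝ)) * v w := fun a =>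
    integrable_mul_schwartz (by fun_prop) (C := 1) (n := 0)
      (fun w => by rw [norm_exp_I_mul]; simp) v
  have h0 : ∀ a : ℝ, fourierS v (pt a σ) = fourierConst *
      ∫ w : Space, Complex.exp (Complex.I * (inner ℝ (pt a σ) w : ℝ)) * v w := by
    intro a
    rw [fourierS_apply, ← fourierConst]
    simp only [mul_comm]
  -- Antisymmetrising in `t` turns the exponential into a sine.
  have h1 : fourierS v (pt t σ) = (1 / 2) * (fourierS v (pt t σ) - fourierS v (pt (-t) σ)) := by
    rw [fourierS_mem_SOdd hv]; ring
  have hX : ∀ X : ℂ, (1 / 2 : ℂ) * (fourierConst * X) =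
      (Complex.I * fourierConst) * ((1 / (2 * Complex.I)) * X) := fun X => by field_simp
  rw [h1, h0, h0, ← mul_sub, ← integral_sub (hint t) (hint (-t)),
    hX, ← integral_const_mul]
  congr 1
  refine integral_congr_ae (Eventually.of_forall fun w => ?_)
  simp only [inner_space, pt_fst, pt_snd, Complex.ofReal_sin, Complex.sin, Complex.ofReal_add,
    mul_add, Complex.exp_add]
  push_cast
  have e1 : Complex.exp (Complex.I * (-t * w.fst)) = Complex.exp (-(t * w.fst) * Complex.I) := by
    congr 1; ring
  have e2 : Complex.exp (Complex.I * (t * w.fst)) = Complex.exp ((t * w.fst) * Complex.I) := by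
    congr 1; ring
  rw [e1, e2, one_div, mul_inv, Complex.inv_I]
  ring

/-- Insert `sin(t y) = t y S(t² y²)` into the sine transform of `F⁻¹φ`. -/
theorem mul_sqrtQuot {φ : 𝓢(Space, ℂ)} (hφ : φ ∈ SOdd) (t : ℝ) (σ : Plane) :
    t * sqrtQuot φ (pt (t ^ 2) σ) = φ (pt t σ) := by
  conv_rhs => rw [← fourierS_fourierSInv φ, fourierS_pt_of_odd (fourierSInv_mem_SOdd hφ)]
  simp only [sqrtQuot, smul_apply, ContinuousLinearMap.comp_apply, sqrtSchwartz_apply, smul_eq_mul,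
    pt_fst, leftCutoff_of_nonneg (sq_nonneg t), Complex.ofReal_one, one_mul, sqrtIntegral]
  rw [mul_left_comm, ← integral_const_mul]
  congr 1
  refine integral_congr_ae (Eventually.of_forall fun w => ?_)
  simp only [sqrtKernel, pt_fst, pt_snd, iteratedDeriv_zero]
  rw [← mul_kern_sq, mul_pow]
  push_cast
  ring

/-- Multiplication by the first coordinate. -/
def mulFst : 𝓢(Space, ℂ) →L[ℂ] 𝓢(Space, ℂ) :=
  SchwartzMap.smulLeftCLM ℂ fun w : Space => (w.fst : ℂ)

theorem mulFst_apply (f : 𝓢(Space, ℂ)) (x : Space) : mulFst f x = x.fst * f x := by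
  have : Function.HasTemperateGrowth fun w : Space => (w.fst : ℂ) :=
    (Complex.ofRealCLM ∘L fstC).hasTemperateGrowth
  simp [mulFst, SchwartzMap.smulLeftCLM_apply_apply this]

theorem mulFst_mem_SOdd {f : 𝓢(Space, ℂ)} (hf : f ∈ SEven) : mulFst f ∈ SOdd := by
  intro a v
  rw [mulFst_apply, mulFst_apply, hf, pt_fst, pt_fst]
  push_cast
  ring

theorem continuous_pt_left (σ : Plane) : Continuous fun t => pt t σ := by unfold pt; fun_prop

/-- Cancel `t` for `t ≠ 0`; the value at `t = 0` follows by continuity. -/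
theorem sqrtQuot_mulFst {ψ : 𝓢(Space, ℂ)} (hψ : ψ ∈ SEven) (t : ℝ) (σ : Plane) :
    sqrtQuot (mulFst ψ) (pt (t ^ 2) σ) = ψ (pt t σ) := by
  have hc1 : Continuous fun t : ℝ => sqrtQuot (mulFst ψ) (pt (t ^ 2) σ) :=
    (sqrtQuot (mulFst ψ)).continuous.comp ((continuous_pt_left σ).comp (continuous_pow 2))
  have hc2 : Continuous fun t : ℝ => ψ (pt t σ) := ψ.continuous.comp (continuous_pt_left σ)
  refine congrFun (Continuous.ext_on (dense_compl_singleton (0 : ℝ)) hc1 hc2 fun t ht => ?_) t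
  have h := mul_sqrtQuot (mulFst_mem_SOdd hψ) t σ
  rw [mulFst_apply, pt_fst] at h
  exact mul_left_cancel₀ (by exact_mod_cast ht) h

/-- The extension of `ψ(√ω, σ)` to a Schwartz function. -/
def sqrtExt : SEven →L[ℂ] 𝓢(Space, ℂ) := (sqrtQuot ∘L mulFst) ∘L SEven.subtypeL

theorem sqrtExt_apply (ψ : SEven) {ω : ℝ} (hω : 0 ≤ ω) (σ : Plane) :
    sqrtExt ψ (pt ω σ) = (ψ : 𝓢(Space, ℂ)) (pt (√ω) σ) := by
  have := sqrtQuot_mulFst ψ.2 (√ω) σ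
  rwa [Real.sq_sqrt hω] at this

/-- The map `(ω, σ) ↦ (ω² + c |σ|², σ)`. -/
def quadMap (c : ℝ) (x : Space) : Space := pt (x.fst ^ 2 + c * ‖x.snd‖ ^ 2) x.snd

theorem quadMap_temperate (c : ℝ) : (quadMap c).HasTemperateGrowth := by
  have h1 : Function.HasTemperateGrowth fun x : Space => x.fst := fstC.hasTemperateGrowth
  have h2 : Function.HasTemperateGrowth fun x : Space => ‖x.snd‖ ^ 2 :=
    Function.HasTemperateGrowth.comp (f := fun x : Space => x.snd)
      (Function.hasTemperateGrowth_norm_sq Plane) sndC.hasTemperateGrowth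
  have h3 : Function.HasTemperateGrowth fun x : Space => x.fst ^ 2 + c * ‖x.snd‖ ^ 2 :=
    (h1.pow 2).add ((Function.HasTemperateGrowth.const c).mul h2)
  have h4 : Function.HasTemperateGrowth fun x : Space =>
      (x.fst ^ 2 + c * ‖x.snd‖ ^ 2) • pt 1 0 := h3.smul (Function.HasTemperateGrowth.const _)
  let L : Plane →L[ℝ] Space :=
    (WithLp.prodContinuousLinearEquiv 2 ℝ ℝ Plane).symm.toContinuousLinearMap ∘L
      ContinuousLinearMap.inr ℝ ℝ Plane
  have h5 : Function.HasTemperateGrowth fun x : Space => L x.snd :=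
    (L ∘L sndC).hasTemperateGrowth
  convert! h4.add h5 using 1
  funext x
  apply WithLp.ofLp_injective
  simp [quadMap, pt, L]

/-- The map retains `σ`, so `ω²` is recovered from the image with an error quadratic in `|σ|`,
whatever the sign of `c`. -/
theorem quadMap_upper (c : ℝ) :
    ∃ (k : ℕ) (C : ℝ), ∀ x, ‖x‖ ≤ C * (1 + ‖quadMap c x‖) ^ k := by
  refine ⟨2, 2 + |c|, fun x => ?_⟩
  set N := ‖quadMap c x‖
  have hN : 0 ≤ N := norm_nonneg _
  have h1 : |x.fst ^ 2 + c * ‖x.snd‖ ^ 2| ≤ N := abs_fst_le (quadMap c x)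
  have h2 : ‖x.snd‖ ≤ N := norm_snd_le (quadMap c x)
  have h3 : ‖x.snd‖ ^ 2 ≤ N ^ 2 := by gcongr
  have h4 : -(|c| * ‖x.snd‖ ^ 2) ≤ c * ‖x.snd‖ ^ 2 := by
    rw [← neg_mul]; gcongr; exact neg_abs_le c
  have h5 : |c| * ‖x.snd‖ ^ 2 ≤ |c| * N ^ 2 := by gcongr
  have h6 := (le_abs_self _).trans h1
  have h7 : ‖x‖ ^ 2 ≤ N + (1 + |c|) * N ^ 2 := by rw [norm_sq_space]; nlinarith
  have hc := abs_nonneg c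
  have h8 : ‖x‖ ≤ 1 + ‖x‖ ^ 2 := by nlinarith [sq_nonneg (‖x‖ - 1)]
  nlinarith [mul_nonneg hc hN, mul_nonneg hc (sq_nonneg N)]

/-- Composition with `quadMap c`. -/
def quadComp (c : ℝ) : 𝓢(Space, ℂ) →L[ℂ] 𝓢(Space, ℂ) :=
  compCLM ℂ (quadMap_temperate c) (quadMap_upper c)

theorem quadComp_apply (c : ℝ) (f : 𝓢(Space, ℂ)) (a : ℝ) (σ : Plane) :
    quadComp c f (pt a σ) = f (pt (a ^ 2 + c * ‖σ‖ ^ 2) σ) := rfl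

theorem quadComp_mem_SEven (c : ℝ) (f : 𝓢(Space, ℂ)) : quadComp c f ∈ SEven := by
  intro a v
  rw [quadComp_apply, quadComp_apply, neg_sq]

/-- The map `χ ↦ ω χ(ω² - |σ|², σ)`. -/
def coneComp : 𝓢(Space, ℂ) →L[ℂ] SOdd :=
  (mulFst ∘L quadComp (-1)).codRestrict SOdd fun χ => mulFst_mem_SOdd (quadComp_mem_SEven _ χ)

theorem coneComp_apply (χ : 𝓢(Space, ℂ)) (ω : ℝ) (σ : Plane) :
    (coneComp χ : 𝓢(Space, ℂ)) (pt ω σ) = ω * χ (pt (ω ^ 2 - ‖σ‖ ^ 2) σ) := by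
  change mulFst (quadComp (-1) χ) (pt ω σ) = _
  rw [mulFst_apply, quadComp_apply, pt_fst, neg_one_mul, ← sub_eq_add_neg]

/-- The map `E` with `F E ψ = c E₁ E₂ F ψ`. -/
def coneExt (c : ℂ) : SEven →L[ℂ] SOdd :=
  c • (fourierSInv ∘L SOdd.subtypeL ∘L coneComp ∘L sqrtExt ∘L fourierEven).codRestrict SOdd
    fun ψ => fourierSInv_mem_SOdd (coneComp (sqrtExt (fourierEven ψ))).2

theorem fourierS_coneExt (c : ℂ) (ψ : SEven) :
    fourierS (coneExt c ψ) = c • (coneComp (sqrtExt (fourierEven ψ)) : 𝓢(Space, ℂ)) := by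
  change fourierS (c • fourierSInv _) = _
  rw [map_smul, fourierS_fourierSInv]
  rfl

theorem coneFormula_of_fourierS_eq {c : ℂ} {E : SEven →L[ℂ] SOdd}
    (h : ∀ ψ : SEven, fourierS (E ψ) =
      c • (coneComp (sqrtExt (fourierEven ψ)) : 𝓢(Space, ℂ))) : ConeFormula c E := by
  intro ψ ω σ hσ
  have h0 : 0 ≤ ω ^ 2 - ‖σ‖ ^ 2 := by
    rw [sub_nonneg, ← sq_abs ω]; gcongr
  rw [h, smul_apply, coneComp_apply, sqrtExt_apply _ h0, smul_eq_mul, mul_assoc]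
  have h1 : (fourierEven ψ : 𝓢(Space, ℂ)) = fourierS ψ := rfl
  rw [h1]
  rcases lt_trichotomy ω 0 with hω | hω | hω
  · rw [Real.sign_of_neg hω, neg_one_mul, fourierS_mem_SEven ψ.2]
  · simp [hω]
  · rw [Real.sign_of_pos hω, one_mul]

/-! ### The Fourier transform of radial functions on `ℝ³`. -/

theorem integrable_space_iff {f : Space → ℂ} :
    Integrable f ↔ Integrable fun p : ℝ × Plane => f (pt p.1 p.2) :=
  ((WithLp.volume_preserving_toLp ℝ Plane).integrable_comp_emb
    (MeasurableEquiv.toLp 2 (ℝ × Plane)).measurableEmbedding (g := f)).symm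

theorem integral_space_eq_prod (f : Space → ℂ) :
    ∫ x, f x = ∫ p : ℝ × Plane, f (pt p.1 p.2) :=
  ((WithLp.volume_preserving_toLp ℝ Plane).integral_comp
    (MeasurableEquiv.toLp 2 (ℝ × Plane)).measurableEmbedding f).symm

theorem integral_space {f : Space → ℂ} (hf : Integrable f) :
    ∫ x, f x = ∫ a : ℝ, ∫ v : Plane, f (pt a v) := by
  rw [integral_space_eq_prod]
  exact integral_prod _ (integrable_space_iff.1 hf)

theorem integral_space_symm {f : Space → ℂ} (hf : Integrable f) :
    ∫ x, f x = ∫ v : Plane, ∫ a : ℝ, f (pt a v) := by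
  rw [integral_space_eq_prod]
  exact integral_prod_symm _ (integrable_space_iff.1 hf)

/-- Polar coordinates, then the substitution `s = b + ρ²`. -/
theorem integral_plane_norm_sq (h : ℝ → ℂ) (b : ℝ) :
    ∫ v : Plane, h (b + ‖v‖ ^ 2) = Real.pi * ∫ s in Set.Ioi b, h s := by
  have h1 := integral_fun_norm_addHaar (volume : Measure Plane) fun y => h (b + y ^ 2)
  have h2 : (volume : Measure Plane).real (Metric.ball 0 1) = Real.pi := by
    rw [Measure.real, EuclideanSpace.volume_ball_fin_two]
    simp [Real.pi_pos.le]
  have h3 := integral_comp_rpow_Ioi (fun w => h (b + w)) (p := 2) two_ne_zero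
  have h4 : ∫ w in Set.Ioi (0 : ℝ), h (b + w) = ∫ s in Set.Ioi b, h s := by
    have := (measurePreserving_add_left (volume : Measure ℝ) b).setIntegral_preimage_emb
      (measurableEmbedding_addLeft b) h (Set.Ioi b)
    rwa [Set.preimage_const_add_Ioi, sub_self] at this
  rw [h1, h2, ← h4, ← h3, finrank_euclideanSpace_fin]
  simp only [nsmul_eq_mul, Complex.real_smul, Nat.add_one_sub_one, pow_one, abs_two,
    show (2 : ℝ) - 1 = 1 by norm_num, Real.rpow_one, Real.rpow_two]
  push_cast
  simp only [mul_assoc, integral_const_mul]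
  ring

theorem hasDerivAt_integral_Ioi {h : ℝ → ℂ} (hc : Continuous h) (hi : Integrable h) (b : ℝ) :
    HasDerivAt (fun b => ∫ s in Set.Ioi b, h s) (-h b) b := by
  have h1 : (fun b => ∫ s in Set.Ioi b, h s) =
      fun b => (∫ s in Set.Ioi 0, h s) - ∫ s in (0 : ℝ)..b, h s := by
    funext b
    rw [← intervalIntegral.integral_Ioi_sub_Ioi' (hi.integrableOn) (hi.integrableOn), sub_sub_cancel]
  rw [h1]
  exact (hc.integral_hasStrictDerivAt 0 b).hasDerivAt.const_sub _

/-- Integrating over the planes `z.fst = a` leaves `π ∫_{a²}^∞ h`, whose derivative in `a` is `-2π a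
h(a²)`; one integration by parts in `a` finishes. -/
theorem integral_norm_sq_mul_exp {h : ℝ → ℂ} (hc : Continuous h) (hi : Integrable h)
    (hs : Integrable fun z : Space => h (‖z‖ ^ 2)) (ht : Integrable fun t : ℝ => t * h (t ^ 2))
    {r : ℝ} (hr : r ≠ 0) :
    ∫ z : Space, h (‖z‖ ^ 2) * Complex.exp (Complex.I * (r * z.fst : ℝ)) =
      2 * Real.pi / (Complex.I * r) *
        ∫ t : ℝ, t * h (t ^ 2) * Complex.exp (Complex.I * (r * t : ℝ)) := by
  have hexp : ∀ {X : Type} [MeasurableSpace X] [TopologicalSpace X] [OpensMeasurableSpace X]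
      {μ : Measure X} {g : X → ℂ} {p : X → ℝ}, Integrable g μ → Continuous p →
      Integrable (fun x => g x * Complex.exp (Complex.I * (p x : ℝ))) μ := by
    intro X _ _ _ μ g p hg hp
    refine hg.mul_bdd (c := 1) (Continuous.aestronglyMeasurable (by fun_prop))
      (Eventually.of_forall fun x => (norm_exp_I_mul _).le)
  have hs' : Integrable fun z : Space => h (‖z‖ ^ 2) * Complex.exp (Complex.I * (r * z.fst : ℝ)) :=
    hexp hs (by fun_prop)
  have hnorm : ∀ (a : ℝ) (v : Plane), ‖pt a v‖ ^ 2 = a ^ 2 + ‖v‖ ^ 2 := fun a v => by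
    rw [norm_sq_space, pt_fst, pt_snd]
  have hinner : ∀ a : ℝ, ∫ v : Plane, h (‖pt a v‖ ^ 2) *
      Complex.exp (Complex.I * (r * (pt a v).fst : ℝ)) =
      (Real.pi * ∫ s in Set.Ioi (a ^ 2), h s) * Complex.exp (Complex.I * (r * a : ℝ)) := by
    intro a
    simp only [hnorm, pt_fst]
    rw [integral_mul_const, integral_plane_norm_sq]
  -- Fubini gives integrability of this marginal, hence the integration by parts has no boundary
  -- terms.
  have hM : Integrable fun a : ℝ =>
      (Real.pi * ∫ s in Set.Ioi (a ^ 2), h s) * Complex.exp (Complex.I * (r * a : ℝ)) := by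
    simpa only [hinner] using (integrable_space_iff.1 hs').integral_prod_left
  rw [integral_space hs', integral_congr_ae (Eventually.of_forall hinner)]
  have hrc : (r : ℂ) ≠ 0 := by exact_mod_cast hr
  have hu : ∀ a : ℝ, HasDerivAt (fun a : ℝ => Real.pi * ∫ s in Set.Ioi (a ^ 2), h s)
      (-(2 * Real.pi * (a * h (a ^ 2)))) a := by
    intro a
    have h1 := (HasDerivAt.scomp (h := fun x : ℝ => x ^ 2) a
      (hasDerivAt_integral_Ioi hc hi (a ^ 2)) (hasDerivAt_pow 2 a)).const_mul (Real.pi : ℂ)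
    convert! h1 using 1
    simp
    ring
  have hv : ∀ a : ℝ, HasDerivAt
      (fun a : ℝ => Complex.exp (Complex.I * (r * a : ℝ)) / (Complex.I * r))
      (Complex.exp (Complex.I * (r * a : ℝ))) a := by
    intro a
    have h1 : HasDerivAt (fun a : ℝ => Complex.I * (r * a : ℝ)) (Complex.I * r) a := by
      simpa using (((hasDerivAt_id a).const_mul r).ofReal_comp).const_mul Complex.I
    convert! h1.cexp.div_const (Complex.I * r) using 1
    field_simp [Complex.I_ne_zero]
  have := integral_mul_deriv_eq_deriv_mul_of_integrable (fun a _ => hu a) (fun a _ => hv a) hM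
    ?_ ?_
  · rw [this, ← integral_neg, ← integral_const_mul]
    refine integral_congr_ae (Eventually.of_forall fun a => ?_)
    simp only
    ring
  · have h1 := ((hexp ht (p := fun t => r * t) (by fun_prop)).const_mul
      (-(2 * Real.pi))).div_const (Complex.I * r)
    refine h1.congr (Eventually.of_forall fun a => ?_)
    simp only [Pi.mul_apply]
    ring
  · refine (hM.div_const (Complex.I * r)).congr (Eventually.of_forall fun a => ?_)
    simp only [Pi.mul_apply]
    ring

/-- The exponents `2` and `3` are the least integers giving integrability on `ℝ` and `ℝ²`. -/
theorem exists_decay (H : 𝓢(Space, ℂ)) : ∃ C, 0 ≤ C ∧ ∀ (s : ℝ) (ξ : Plane),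
    ‖H (pt s ξ)‖ ≤ C * ((1 + |s|) ^ 2)⁻¹ * ((1 + ‖ξ‖) ^ 3)⁻¹ := by
  refine ⟨2 ^ 5 * ((Finset.Iic (5, 0)).sup fun m => SchwartzMap.seminorm ℂ m.1 m.2) H,
    by positivity, fun s ξ => ?_⟩
  have h := SchwartzMap.one_add_le_sup_seminorm_apply (𝕜 := ℂ) (m := (5, 0)) (le_refl 5)
    (le_refl 0) H (pt s ξ)
  rw [norm_iteratedFDeriv_zero] at h
  have h1 : |s| ≤ ‖pt s ξ‖ := abs_fst_le (pt s ξ)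
  have h2 : ‖ξ‖ ≤ ‖pt s ξ‖ := norm_snd_le (pt s ξ)
  have h3 : (1 + |s|) ^ 2 * (1 + ‖ξ‖) ^ 3 ≤ (1 + ‖pt s ξ‖) ^ 5 := by
    rw [show (1 + ‖pt s ξ‖) ^ 5 = (1 + ‖pt s ξ‖) ^ 2 * (1 + ‖pt s ξ‖) ^ 3 by ring]
    gcongr
  rw [← div_eq_mul_inv, ← div_eq_mul_inv, div_div, le_div_iff₀ (by positivity), mul_comm]
  exact (mul_le_mul_of_nonneg_right h3 (norm_nonneg _)).trans h

theorem integrable_inv_one_add_norm_pow {V : Type*} [NormedAddCommGroup V] [NormedSpace ℝ V]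
    [FiniteDimensional ℝ V] [MeasurableSpace V] [BorelSpace V] {μ : Measure V}
    [μ.IsAddHaarMeasure] {n : ℕ} (hn : Module.finrank ℝ V < n) :
    Integrable (fun x : V => ((1 + ‖x‖) ^ n)⁻¹) μ := by
  refine (integrable_one_add_norm (μ := μ) (r := n) (by exact_mod_cast hn)).congr
    (Eventually.of_forall fun x => ?_)
  simp only
  rw [Real.rpow_neg (by positivity), Real.rpow_natCast]

/-- Substituting `s²` doubles the decay exponent to `4`, enough for integrability on `ℝ³`. -/
theorem exists_decay_norm_sq (H : 𝓢(Space, ℂ)) : ∃ C, 0 ≤ C ∧ ∀ (s : ℝ) (ξ : Plane),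
    ‖H (pt (s ^ 2) ξ)‖ ≤ C * ((1 + |s|) ^ 4)⁻¹ * ((1 + ‖ξ‖) ^ 3)⁻¹ := by
  obtain ⟨C, hC, h⟩ := exists_decay H
  refine ⟨C * 4, by positivity, fun s ξ => (h (s ^ 2) ξ).trans ?_⟩
  rw [mul_assoc C 4]
  gcongr
  rw [← div_eq_mul_inv, inv_le_comm₀ (by positivity) (by positivity), inv_div,
    div_le_iff₀ (by norm_num), abs_of_nonneg (sq_nonneg s), ← sq_abs s]
  have h0 := abs_nonneg s
  have h1 : (1 + |s|) ^ 2 ≤ 2 * (1 + |s| ^ 2) := by nlinarith [sq_nonneg (1 - |s|)]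
  calc (1 + |s|) ^ 4 = ((1 + |s|) ^ 2) ^ 2 := by ring
    _ ≤ (2 * (1 + |s| ^ 2)) ^ 2 := by gcongr
    _ = _ := by ring

theorem continuous_pt : Continuous fun p : ℝ × Plane => pt p.1 p.2 := by unfold pt; fun_prop

/-- A reflection exchanges two vectors of equal norm. -/
theorem exists_isometry_pt (η : Space) : ∃ ρ : Space ≃ₗᵢ[ℝ] Space, ρ (pt ‖η‖ 0) = η := by
  have h : ‖pt ‖η‖ 0‖ = ‖η‖ := by
    rw [← sq_eq_sq₀ (norm_nonneg _) (norm_nonneg _), norm_sq_space]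
    simp [pt]
  exact ⟨_, Submodule.reflection_sub h⟩

theorem integral_schwartz_norm_sq (H : 𝓢(Space, ℂ)) (ξ : Plane) {η : Space} (hη : η ≠ 0) :
    ∫ z : Space, H (pt (‖z‖ ^ 2) ξ) * Complex.exp (Complex.I * (inner ℝ η z : ℝ)) =
      2 * Real.pi / (Complex.I * ‖η‖) *
        ∫ t : ℝ, t * H (pt (t ^ 2) ξ) * Complex.exp (Complex.I * (‖η‖ * t : ℝ)) := by
  obtain ⟨ρ, hρ⟩ := exists_isometry_pt η
  obtain ⟨C, hC, hd⟩ := exists_decay H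
  obtain ⟨C', hC', hd'⟩ := exists_decay_norm_sq H
  have hcH : Continuous fun s : ℝ => H (pt s ξ) := H.continuous.comp (continuous_pt_left ξ)
  have h1 : ∀ z : Space, H (pt (‖ρ z‖ ^ 2) ξ) * Complex.exp (Complex.I * (inner ℝ η (ρ z) : ℝ)) =
      H (pt (‖z‖ ^ 2) ξ) * Complex.exp (Complex.I * (‖η‖ * z.fst : ℝ)) := by
    intro z
    conv_lhs => rw [← hρ]
    rw [ρ.inner_map_map, ρ.norm_map, inner_space, pt_fst, pt_snd, inner_zero_left, add_zero]
  rw [← (ρ.measurePreserving).integral_comp ρ.toHomeomorph.measurableEmbedding,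
    integral_congr_ae (Eventually.of_forall h1)]
  refine integral_norm_sq_mul_exp hcH ?_ ?_ ?_ (norm_ne_zero_iff.2 hη)
  · refine Integrable.mono' (((integrable_inv_one_add_norm_pow (V := ℝ) (μ := volume) (n := 2)
      (by simp)).const_mul C).mul_const ((1 + ‖ξ‖) ^ 3)⁻¹) hcH.aestronglyMeasurable
      (Eventually.of_forall fun s => hd s ξ)
  · refine Integrable.mono' (((integrable_inv_one_add_norm_pow (V := Space) (μ := volume) (n := 4)
      (by rw [finrank_space]; norm_num)).const_mul C').mul_const ((1 + ‖ξ‖) ^ 3)⁻¹)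
      (Continuous.aestronglyMeasurable (hcH.comp (by fun_prop)))
      (Eventually.of_forall fun z => ?_)
    simpa using hd' ‖z‖ ξ
  · refine Integrable.mono' (((integrable_inv_one_add_norm_pow (V := ℝ) (μ := volume) (n := 3)
      (by simp)).const_mul C').mul_const ((1 + ‖ξ‖) ^ 3)⁻¹)
      (Continuous.aestronglyMeasurable (Complex.continuous_ofReal.mul
        (hcH.comp (continuous_pow 2)))) (Eventually.of_forall fun t => ?_)
    rw [norm_mul, Complex.norm_real]
    calc ‖t‖ * ‖H (pt (t ^ 2) ξ)‖ ≤ (1 + ‖t‖) * (C' * ((1 + |t|) ^ 4)⁻¹ * ((1 + ‖ξ‖) ^ 3)⁻¹) := by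
          gcongr
          · linarith
          · exact hd' t ξ
      _ = _ := by
          rw [Real.norm_eq_abs]
          have : 0 < 1 + |t| := by positivity
          field_simp

/-! ### The operator `R*` in frequency. -/

/-- The integral of `H(|x - ξ|², ξ)` over the plane. -/
def planeIntegral (H : 𝓢(Space, ℂ)) (x : Space) : ℂ := ∫ ξ : Plane, H (pt (‖x - pt 0 ξ‖ ^ 2) ξ)

theorem continuous_pt_right (a : ℝ) : Continuous fun ξ : Plane => pt a ξ := by unfold pt; fun_prop

theorem continuous_planeIntegrand (H : 𝓢(Space, ℂ)) :
    Continuous fun p : Plane × Space => H (pt (‖p.2 - pt 0 p.1‖ ^ 2) p.1) := by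
  have h1 : Continuous fun p : Plane × Space => pt 0 p.1 := (continuous_pt_right 0).comp (by fun_prop)
  exact H.continuous.comp (continuous_pt.comp (Continuous.prodMk (by fun_prop) (by fun_prop)))

theorem finrank_plane_lt : Module.finrank ℝ Plane < 3 := by simp

theorem norm_planeIntegrand_le (H : 𝓢(Space, ℂ)) : ∃ C, 0 ≤ C ∧ ∀ (x : Space) (ξ : Plane),
    ‖H (pt (‖x - pt 0 ξ‖ ^ 2) ξ)‖ ≤ C * ((1 + ‖ξ‖) ^ 3)⁻¹ := by
  obtain ⟨C, hC, hd⟩ := exists_decay H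
  refine ⟨C, hC, fun x ξ => (hd _ ξ).trans ?_⟩
  gcongr
  refine mul_le_of_le_one_right hC (inv_le_one_of_one_le₀ (one_le_pow₀ ?_))
  linarith [abs_nonneg (‖x - pt 0 ξ‖ ^ 2)]

theorem continuous_planeIntegral (H : 𝓢(Space, ℂ)) : Continuous (planeIntegral H) := by
  obtain ⟨C, hC, hd⟩ := norm_planeIntegrand_le H
  have hi : Integrable fun ξ : Plane => C * ((1 + ‖ξ‖) ^ 3)⁻¹ :=
    (integrable_inv_one_add_norm_pow finrank_plane_lt).const_mul C
  have h1 : ∀ x : Space, Continuous fun ξ : Plane => H (pt (‖x - pt 0 ξ‖ ^ 2) ξ) :=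
    fun x => H.continuous.comp (continuous_pt.comp
      (Continuous.prodMk (by have := continuous_pt_right 0; fun_prop) continuous_id))
  have h2 : ∀ ξ : Plane, Continuous fun x : Space => H (pt (‖x - pt 0 ξ‖ ^ 2) ξ) :=
    fun ξ => H.continuous.comp (continuous_pt.comp
      (Continuous.prodMk (by fun_prop) continuous_const))
  exact continuous_of_dominated (fun x => (h1 x).aestronglyMeasurable)
    (fun x => Eventually.of_forall (hd x)) hi (Eventually.of_forall h2)

theorem integrable_planeBound (C : ℝ) (hC : 0 ≤ C) : Integrable fun p : Plane × Space =>
    C * ((1 + ‖p.2 - pt 0 p.1‖) ^ 4)⁻¹ * ((1 + ‖p.1‖) ^ 3)⁻¹ := by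
  have h1 : Continuous fun p : Plane × Space => pt 0 p.1 := (continuous_pt_right 0).comp (by fun_prop)
  have hf : Integrable fun z : Space => C * ((1 + ‖z‖) ^ 4)⁻¹ :=
    (integrable_inv_one_add_norm_pow (by rw [finrank_space]; norm_num)).const_mul C
  have hc : Continuous fun p : Plane × Space =>
      C * ((1 + ‖p.2 - pt 0 p.1‖) ^ 4)⁻¹ * ((1 + ‖p.1‖) ^ 3)⁻¹ := by
    have h2 : ∀ p : Plane × Space, (1 + ‖p.2 - pt 0 p.1‖) ^ 4 ≠ 0 := fun p => by positivity
    have h3 : ∀ p : Plane × Space, (1 + ‖p.1‖) ^ 3 ≠ 0 := fun p => by positivity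
    exact ((continuous_const.mul (Continuous.inv₀ (by fun_prop) h2))).mul
      (Continuous.inv₀ (by fun_prop) h3)
  have h2 : ∀ ξ : Plane, ∫ z : Space, ‖C * ((1 + ‖z - pt 0 ξ‖) ^ 4)⁻¹ * ((1 + ‖ξ‖) ^ 3)⁻¹‖ =
      (∫ z : Space, C * ((1 + ‖z‖) ^ 4)⁻¹) * ((1 + ‖ξ‖) ^ 3)⁻¹ := by
    intro ξ
    rw [← integral_sub_right_eq_self (fun z : Space => C * ((1 + ‖z‖) ^ 4)⁻¹) (pt 0 ξ),
      ← integral_mul_const]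
    refine integral_congr_ae (Eventually.of_forall fun z => Real.norm_of_nonneg ?_)
    positivity
  have h3 : ∀ ξ : Plane, Integrable fun z : Space =>
      C * ((1 + ‖z - pt 0 ξ‖) ^ 4)⁻¹ * ((1 + ‖ξ‖) ^ 3)⁻¹ := fun ξ =>
    (hf.comp_sub_right (pt 0 ξ)).mul_const _
  have h4 : Integrable fun ξ : Plane => ∫ z : Space,
      ‖C * ((1 + ‖z - pt 0 ξ‖) ^ 4)⁻¹ * ((1 + ‖ξ‖) ^ 3)⁻¹‖ := by
    simp only [h2]
    exact (integrable_inv_one_add_norm_pow finrank_plane_lt).const_mul _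
  exact (integrable_prod_iff hc.aestronglyMeasurable).2 ⟨Eventually.of_forall h3, h4⟩

theorem integrable_planeIntegrand (H : 𝓢(Space, ℂ)) :
    Integrable fun p : Plane × Space => H (pt (‖p.2 - pt 0 p.1‖ ^ 2) p.1) := by
  obtain ⟨C, hC, hd⟩ := exists_decay_norm_sq H
  refine (integrable_planeBound C hC).mono' (continuous_planeIntegrand H).aestronglyMeasurable
    (Eventually.of_forall fun p => ?_)
  have := hd ‖p.2 - pt 0 p.1‖ p.1
  rwa [abs_norm] at this

theorem integrable_planeIntegral (H : 𝓢(Space, ℂ)) : Integrable (planeIntegral H) :=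
  (integrable_planeIntegrand H).integral_prod_right

/-- Exchange the integrals and translate by `(0, ξ)`: this releases the phase `exp(i σ·ξ)` and
leaves a radial function of `z`. -/
theorem integral_planeIntegral_mul_exp (H : 𝓢(Space, ℂ)) {η : Space} (hη : η ≠ 0) :
    ∫ x, planeIntegral H x * Complex.exp (Complex.I * (inner ℝ η x : ℝ)) =
      2 * Real.pi / (Complex.I * ‖η‖) * ∫ ξ : Plane, ∫ t : ℝ, t * H (pt (t ^ 2) ξ) *
        Complex.exp (Complex.I * (inner ℝ (pt ‖η‖ η.snd) (pt t ξ) : ℝ)) := by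
  have h1 : ∀ x, planeIntegral H x * Complex.exp (Complex.I * (inner ℝ η x : ℝ)) =
      ∫ ξ : Plane, H (pt (‖x - pt 0 ξ‖ ^ 2) ξ) * Complex.exp (Complex.I * (inner ℝ η x : ℝ)) :=
    fun x => (integral_mul_const _ _).symm
  have hi : Integrable fun p : Plane × Space => H (pt (‖p.2 - pt 0 p.1‖ ^ 2) p.1) *
      Complex.exp (Complex.I * (inner ℝ η p.2 : ℝ)) :=
    (integrable_planeIntegrand H).mul_bdd (c := 1) (Continuous.aestronglyMeasurable (by fun_prop))
      (Eventually.of_forall fun x => (norm_exp_I_mul _).le)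
  have hi' : Integrable (Function.uncurry fun (x : Space) (ξ : Plane) =>
      H (pt (‖x - pt 0 ξ‖ ^ 2) ξ) * Complex.exp (Complex.I * (inner ℝ η x : ℝ)))
      (volume.prod volume) := hi.swap
  rw [integral_congr_ae (Eventually.of_forall h1), integral_integral_swap hi',
    ← integral_const_mul]
  refine integral_congr_ae (Eventually.of_forall fun ξ => ?_)
  have h2 : ∀ x : Space, H (pt (‖x - pt 0 ξ‖ ^ 2) ξ) *
      Complex.exp (Complex.I * (inner ℝ η x : ℝ)) =
      (fun z : Space => Complex.exp (Complex.I * (inner ℝ η.snd ξ : ℝ)) * (H (pt (‖z‖ ^ 2) ξ) *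
        Complex.exp (Complex.I * (inner ℝ η z : ℝ)))) (x - pt 0 ξ) := by
    intro x
    have : (inner ℝ η (pt 0 ξ) : ℝ) = inner ℝ η.snd ξ := by
      rw [inner_space, pt_fst, pt_snd, mul_zero, zero_add]
    simp only
    rw [mul_left_comm, ← Complex.exp_add, inner_sub_right, this]
    push_cast
    congr 2
    ring
  simp only
  rw [integral_congr_ae (Eventually.of_forall h2), integral_sub_right_eq_self
    (fun z : Space => Complex.exp (Complex.I * (inner ℝ η.snd ξ : ℝ)) * (H (pt (‖z‖ ^ 2) ξ) *
        Complex.exp (Complex.I * (inner ℝ η z : ℝ)))), integral_const_mul,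
    integral_schwartz_norm_sq H ξ hη, mul_left_comm, ← integral_const_mul]
  congr 1
  refine integral_congr_ae (Eventually.of_forall fun t => ?_)
  simp only [inner_space, pt_fst, pt_snd]
  rw [mul_left_comm, ← Complex.exp_add]
  push_cast
  congr 2
  ring

theorem rStar_eq_planeIntegral {φ : 𝓢(Space, ℂ)} (hφ : φ ∈ SOdd) (x : Space) :
    rStar φ x = (1 / (4 * Real.pi) : ℂ) * planeIntegral (sqrtQuot φ) x := by
  unfold rStar planeIntegral
  congr 1
  have h : ∀ᵐ ξ : Plane, ξ ≠ x.snd := by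
    simp [ae_iff]
  refine integral_congr_ae (h.mono fun ξ hξ => ?_)
  have hn : ‖x - pt 0 ξ‖ ≠ 0 := by
    rw [norm_ne_zero_iff, sub_ne_zero]
    rintro rfl
    exact hξ rfl
  simp only
  rw [← mul_sqrtQuot hφ, mul_div_cancel_left₀]
  exact_mod_cast hn

theorem integral_rStar_mul_exp {φ : 𝓢(Space, ℂ)} (hφ : φ ∈ SOdd) {η : Space} (hη : η ≠ 0) :
    fourierConst * ∫ x, rStar φ x * Complex.exp (Complex.I * (inner ℝ η x : ℝ)) =
      1 / (2 * Complex.I) * (fourierS φ (pt ‖η‖ η.snd) / ‖η‖) := by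
  have h1 : ∀ x, rStar φ x * Complex.exp (Complex.I * (inner ℝ η x : ℝ)) =
      (1 / (4 * Real.pi) : ℂ) * (planeIntegral (sqrtQuot φ) x *
        Complex.exp (Complex.I * (inner ℝ η x : ℝ))) := fun x => by
    rw [rStar_eq_planeIntegral hφ, mul_assoc]
  have hi : Integrable fun w : Space => φ w *
      Complex.exp (Complex.I * (inner ℝ (pt ‖η‖ η.snd) w : ℝ)) :=
    φ.integrable.mul_bdd (c := 1) (Continuous.aestronglyMeasurable (by fun_prop))
      (Eventually.of_forall fun x => (norm_exp_I_mul _).le)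
  rw [integral_congr_ae (Eventually.of_forall h1), integral_const_mul,
    integral_planeIntegral_mul_exp _ hη, fourierS_apply, ← fourierConst, integral_space_symm hi]
  simp only [mul_sqrtQuot hφ]
  have hpi : (Real.pi : ℂ) ≠ 0 := by exact_mod_cast Real.pi_ne_zero
  field_simp [Complex.I_ne_zero]
  ring

/-- The excluded point is a null set, so the transforms agree almost everywhere and are integrable;
inversion holds pointwise because both functions are continuous. -/
theorem eq_schwartz_of_fourier_eq {f : Space → ℂ} (hc : Continuous f) (hi : Integrable f)
    (u : 𝓢(Space, ℂ)) (h : ∀ η : Space, η ≠ 0 →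
      fourierConst * ∫ x, f x * Complex.exp (Complex.I * (inner ℝ η x : ℝ)) = fourierS u η) :
    f = u := by
  have h1 : ∀ (g : Space → ℂ) (w : Space), 𝓕 g w =
      ∫ x, g x * Complex.exp (Complex.I * (inner ℝ (-(2 * Real.pi) • w) x : ℝ)) := by
    intro g w
    rw [Real.fourier_eq']
    refine integral_congr_ae (Eventually.of_forall fun x => ?_)
    simp only [inner_smul_left, smul_eq_mul, real_inner_comm w x]
    rw [mul_comm]
    congr 2
    simp
    ring
  have h2 : 𝓕 f =ᵐ[volume] 𝓕 (u : Space → ℂ) := by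
    have h0 : ∀ᵐ w : Space, w ≠ 0 := by simp [ae_iff]
    refine h0.mono fun w hw => ?_
    rw [h1, h1]
    have h3 := h (-(2 * Real.pi) • w) (smul_ne_zero (by simp [Real.pi_ne_zero]) hw)
    rw [fourierS_apply, ← fourierConst] at h3
    exact mul_left_cancel₀ fourierConst_ne_zero h3
  have hu : Integrable (𝓕 (u : Space → ℂ)) := by
    rw [← SchwartzMap.fourier_coe]; exact (𝓕 u).integrable
  have h3 : 𝓕⁻ (𝓕 f) = 𝓕⁻ (𝓕 (u : Space → ℂ)) := by
    funext w
    rw [Real.fourierInv_eq', Real.fourierInv_eq']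
    refine integral_congr_ae (h2.mono fun x hx => ?_)
    simp only [hx]
  rwa [hc.fourierInv_fourier_eq hi (hu.congr h2.symm),
    u.continuous.fourierInv_fourier_eq u.integrable hu] at h3

/-- `R*` on the odd Schwartz functions, defined on the Fourier side. -/
def rStarOdd : 𝓢(Space, ℂ) →L[ℂ] 𝓢(Space, ℂ) :=
  (1 / (2 * Complex.I)) • (fourierSInv ∘L quadComp 1 ∘L sqrtQuot ∘L fourierS)

theorem rStarOdd_mem_SEven (φ : 𝓢(Space, ℂ)) : rStarOdd φ ∈ SEven :=
  SEven.smul_mem _ (fourierSInv_mem_SEven (quadComp_mem_SEven _ _))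

theorem norm_pt (ϱ : ℝ) (σ : Plane) : ‖pt ϱ σ‖ = √(‖σ‖ ^ 2 + ϱ ^ 2) := by
  rw [eq_comm, Real.sqrt_eq_iff_mul_self_eq (by positivity) (norm_nonneg _), ← sq, norm_sq_space,
    pt_fst, pt_snd, add_comm]

theorem fourierS_rStarOdd {φ : 𝓢(Space, ℂ)} (hφ : φ ∈ SOdd) {η : Space} (hη : η ≠ 0) :
    fourierS (rStarOdd φ) η = 1 / (2 * Complex.I) * (fourierS φ (pt ‖η‖ η.snd) / ‖η‖) := by
  have h1 : fourierS (rStarOdd φ) η =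
      1 / (2 * Complex.I) * sqrtQuot (fourierS φ) (pt (‖η‖ ^ 2) η.snd) := by
    simp only [rStarOdd, smul_apply, map_smul, ContinuousLinearMap.comp_apply, fourierS_fourierSInv,
      smul_eq_mul]
    rw [← pt_fst_snd η, quadComp_apply, norm_sq_space, one_mul]
    rfl
  have hn : (‖η‖ : ℂ) ≠ 0 := by exact_mod_cast norm_ne_zero_iff.2 hη
  rw [h1, ← mul_sqrtQuot (fourierS_mem_SOdd hφ), mul_div_cancel_left₀ _ hn]

theorem rStarOdd_apply {φ : 𝓢(Space, ℂ)} (hφ : φ ∈ SOdd) (x : Space) :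
    rStarOdd φ x = rStar φ x := by
  have h : rStar φ = fun x => (1 / (4 * Real.pi) : ℂ) * planeIntegral (sqrtQuot φ) x :=
    funext (rStar_eq_planeIntegral hφ)
  refine (congrFun (eq_schwartz_of_fourier_eq ?_ ?_ (rStarOdd φ) fun η hη => ?_) x).symm
  · rw [h]; exact continuous_const.mul (continuous_planeIntegral _)
  · rw [h]; exact (integrable_planeIntegral _).const_mul _
  · rw [integral_rStar_mul_exp hφ hη, fourierS_rStarOdd hφ hη]

/-- Twice the odd part of a Schwartz function. -/
def oddPart : 𝓢(Space, ℂ) →L[ℂ] 𝓢(Space, ℂ) := ContinuousLinearMap.id ℂ _ - reflectCLM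

theorem oddPart_eq (φ : 𝓢(Space, ℂ)) : oddPart φ = φ - reflectCLM φ := rfl

theorem oddPart_mem_SOdd (φ : 𝓢(Space, ℂ)) : oddPart φ ∈ SOdd := by
  rw [mem_SOdd_iff, oddPart_eq, map_sub, reflectCLM_reflectCLM, neg_sub]

/-- `R*` on the Schwartz functions supported in `t ≥ 0`. -/
def rStarPlus : SPlus →L[ℂ] SEven :=
  (rStarOdd ∘L oddPart ∘L SPlus.subtypeL).codRestrict SEven fun _ => rStarOdd_mem_SEven _

theorem rStarPlus_coe (φ : SPlus) :
    (rStarPlus φ : 𝓢(Space, ℂ)) = rStarOdd (oddPart φ) := rfl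

theorem rStar_oddPart (φ : SPlus) (x : Space) : rStar (oddPart φ) x = rStar φ x := by
  unfold rStar
  congr 1
  have h : ∀ᵐ ξ : Plane, ξ ≠ x.snd := by
    simp [ae_iff]
  refine integral_congr_ae (h.mono fun ξ hξ => ?_)
  have hn : 0 < ‖x - pt 0 ξ‖ := by
    rw [norm_pos_iff, sub_ne_zero]
    rintro rfl
    exact hξ rfl
  simp only [oddPart_eq, sub_apply, reflectCLM_apply, reflect_pt]
  rw [φ.2 _ _ (neg_lt_zero.2 hn), sub_zero]

theorem rStarPlus_apply (φ : SPlus) (x : Space) :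
    (rStarPlus φ : 𝓢(Space, ℂ)) x = rStar φ x := by
  rw [rStarPlus_coe, rStarOdd_apply (oddPart_mem_SOdd _), rStar_oddPart]

theorem fourierS_oddPart (φ : 𝓢(Space, ℂ)) (a : ℝ) (σ : Plane) :
    fourierS (oddPart φ) (pt a σ) = fourierS φ (pt a σ) - fourierS φ (pt (-a) σ) := by
  rw [oddPart_eq, map_sub, fourierS_reflectCLM, sub_apply, reflectCLM_apply, reflect_pt]

theorem fourierS_rStarPlus (φ : SPlus) (ϱ : ℝ) (σ : Plane) (h : pt ϱ σ ≠ 0) :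
    fourierS (rStarPlus φ) (pt ϱ σ) = (1 / (2 * Complex.I)) *
      ((fourierS φ (pt (√(‖σ‖ ^ 2 + ϱ ^ 2)) σ) - fourierS φ (pt (-√(‖σ‖ ^ 2 + ϱ ^ 2)) σ)) /
        (√(‖σ‖ ^ 2 + ϱ ^ 2) : ℂ)) := by
  rw [rStarPlus_coe, fourierS_rStarOdd (oddPart_mem_SOdd _) h, norm_pt, pt_snd, fourierS_oddPart]

/-- At frequency `η = (ϱ, σ)` the cone formula is used at `ω = ‖η‖`, where `√(ω² - |σ|²) = |ϱ|`. The
factors `2i ω` and `1 / (2i ‖η‖)` cancel, and evenness of `Fψ` removes the absolute value. -/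
theorem rStar_of_coneFormula {E : SEven →L[ℂ] SOdd} (hE : ConeFormula (2 * Complex.I) E)
    (ψ : SEven) (x : Space) : rStar (E ψ) x = (ψ : 𝓢(Space, ℂ)) x := by
  rw [← rStarOdd_apply (E ψ).2]
  refine congrFun (eq_schwartz_of_fourier_eq (rStarOdd (E ψ)).continuous
    (rStarOdd (E ψ)).integrable ψ fun η hη => ?_) x
  rw [fourierConst, ← fourierS_apply, fourierS_rStarOdd (E ψ).2 hη]
  have h0 : 0 < ‖η‖ := norm_pos_iff.2 hη
  have h1 : ‖η.snd‖ ≤ |‖η‖| := by rw [abs_norm]; exact norm_snd_le η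
  rw [hE ψ ‖η‖ η.snd h1, Real.sign_of_pos h0, one_mul, norm_sq_space, add_sub_cancel_right,
    Real.sqrt_sq_eq_abs]
  have hn : (‖η‖ : ℂ) ≠ 0 := by exact_mod_cast h0.ne'
  have h2 : fourierS ψ (pt |η.fst| η.snd) = fourierS ψ η := by
    rcases abs_choice η.fst with h | h <;> rw [h]
    · rfl
    · rw [fourierS_mem_SEven ψ.2]; rfl
  rw [h2]
  field_simp [Complex.I_ne_zero]

/-! ### Distributions vanishing on an open set, tested on functions flat on the complement. -/

section Flat

open scoped ContDiff

variable {E : Type*} [NormedAddCommGroup E] [NormedSpace ℝ E]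

/-- All derivatives vanish at `z`, so the mean value inequality on the segment from `z` to `x` gains
one power of `δ` per derivative. The constant is uniform in `x` and `z`; since `δ ≤ 1`, the weights
at nearby points differ by at most a factor `2 ^ k`. -/
theorem exists_bound_of_eventually_zero (h : 𝓢(E, ℂ)) (N k i : ℕ) :
    ∃ C, 0 ≤ C ∧ ∀ (x z : E) (δ : ℝ), 0 ≤ δ → δ ≤ 1 → h =ᶠ[𝓝 z] 0 → ‖x - z‖ ≤ δ →
      (1 + ‖x‖) ^ k * ‖iteratedFDeriv ℝ i h x‖ ≤ C * δ ^ N := by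
  induction N generalizing i with
  | zero =>
    refine ⟨2 ^ k * ((Finset.Iic (k, i)).sup fun m => SchwartzMap.seminorm ℂ m.1 m.2) h,
      by positivity, fun x z δ _ _ _ _ => ?_⟩
    simpa using SchwartzMap.one_add_le_sup_seminorm_apply (𝕜 := ℂ) (m := (k, i)) (le_refl k)
      (le_refl i) h x
  | succ N ih =>
    obtain ⟨C, hC, H⟩ := ih (i + 1)
    refine ⟨2 ^ k * C, by positivity, fun x z δ hδ hδ1 hz hxz => ?_⟩
    have hbound : ∀ y ∈ segment ℝ z x, ‖fderiv ℝ (iteratedFDeriv ℝ i h) y‖ ≤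
        2 ^ k * C * δ ^ N / (1 + ‖x‖) ^ k := by
      intro y hy
      have hyz : ‖y - z‖ ≤ δ := by
        exact (norm_sub_le_of_mem_segment hy).trans hxz
      have hxy : ‖x - y‖ ≤ 1 := by
        rw [segment_symm] at hy
        have h1 := norm_sub_le_of_mem_segment hy
        rw [norm_sub_rev, norm_sub_rev z x] at h1
        exact h1.trans (hxz.trans hδ1)
      have hx : 1 + ‖x‖ ≤ 2 * (1 + ‖y‖) := by
        have := norm_le_norm_add_norm_sub' x y
        linarith [norm_nonneg y]
      rw [norm_fderiv_iteratedFDeriv, le_div_iff₀ (by positivity), mul_comm]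
      calc (1 + ‖x‖) ^ k * ‖iteratedFDeriv ℝ (i + 1) h y‖
          ≤ (2 * (1 + ‖y‖)) ^ k * ‖iteratedFDeriv ℝ (i + 1) h y‖ := by gcongr
        _ = 2 ^ k * ((1 + ‖y‖) ^ k * ‖iteratedFDeriv ℝ (i + 1) h y‖) := by rw [mul_pow]; ring
        _ ≤ 2 ^ k * (C * δ ^ N) :=
          mul_le_mul_of_nonneg_left (H y z δ hδ hδ1 hz hyz) (by positivity)
        _ = _ := by ring
    have hd : ∀ y ∈ segment ℝ z x, DifferentiableAt ℝ (iteratedFDeriv ℝ i h) y := fun y _ =>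
      ((h.smooth ⊤).differentiable_iteratedFDeriv (m := i)
        (mod_cast WithTop.coe_lt_top _)).differentiableAt
    have hmv := (convex_segment z x).norm_image_sub_le_of_norm_fderiv_le hd hbound
      (left_mem_segment ℝ z x) (right_mem_segment ℝ z x)
    have hz0 : iteratedFDeriv ℝ i h z = 0 := by
      rw [(hz.iteratedFDeriv ℝ i).eq_of_nhds]
      simp
    rw [hz0, sub_zero] at hmv
    calc (1 + ‖x‖) ^ k * ‖iteratedFDeriv ℝ i h x‖
        ≤ (1 + ‖x‖) ^ k * (2 ^ k * C * δ ^ N / (1 + ‖x‖) ^ k * δ) := by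
          gcongr
          exact hmv.trans (by gcongr)
      _ = _ := by field_simp; ring

/-- A smooth function that is `1` on `(-∞, 1/2]` and `0` on `[1, ∞)`. -/
def rightCutoff (s : ℝ) : ℝ := 1 - Real.smoothTransition (2 * s - 1)

theorem rightCutoff_contDiff : ContDiff ℝ ∞ rightCutoff :=
  contDiff_const.sub (Real.smoothTransition.contDiff.comp
    ((contDiff_const.mul contDiff_id).sub contDiff_const))

theorem rightCutoff_of_le {s : ℝ} (hs : s ≤ 1 / 2) : rightCutoff s = 1 := by
  rw [rightCutoff, Real.smoothTransition.zero_of_nonpos (by linarith), sub_zero]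

theorem rightCutoff_of_ge {s : ℝ} (hs : 1 ≤ s) : rightCutoff s = 0 := by
  rw [rightCutoff, Real.smoothTransition.one_of_one_le (by linarith), sub_self]

theorem exists_bound_iteratedFDeriv_rightCutoff (i : ℕ) :
    ∃ C, 0 ≤ C ∧ ∀ s, ‖iteratedFDeriv ℝ i rightCutoff s‖ ≤ C := by
  obtain ⟨C, hC⟩ := (isCompact_Icc (a := (0 : ℝ)) (b := 1)).exists_bound_of_continuousOn
    (rightCutoff_contDiff.continuous_iteratedFDeriv (m := i) (mod_cast le_top)).continuousOn
  have hC0 : 0 ≤ C := (norm_nonneg _).trans (hC 0 (by norm_num))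
  have hconst : ∀ (c s : ℝ), |c| ≤ 1 → rightCutoff =ᶠ[𝓝 s] (fun _ => c) →
      ‖iteratedFDeriv ℝ i rightCutoff s‖ ≤ max C 1 := by
    intro c s hc h
    rw [(h.iteratedFDeriv ℝ i).eq_of_nhds]
    rcases i with _ | i
    · rw [norm_iteratedFDeriv_zero]
      exact hc.trans (le_max_right _ _)
    · rw [iteratedFDeriv_const_of_ne (by simp)]
      simp
  refine ⟨max C 1, by positivity, fun s => ?_⟩
  rcases lt_or_ge s 0 with hs | hs
  · refine hconst 1 s (by simp) ?_
    filter_upwards [gt_mem_nhds hs] with y hy using rightCutoff_of_le (by linarith)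
  · rcases le_or_gt s 1 with hs' | hs'
    · exact (hC s ⟨hs, hs'⟩).trans (le_max_left _ _)
    · refine hconst 0 s (by simp) ?_
      filter_upwards [lt_mem_nhds hs'] with y hy using rightCutoff_of_ge hy.le

theorem rightCutoff_temperate : rightCutoff.HasTemperateGrowth :=
  ⟨rightCutoff_contDiff, fun i => by
    obtain ⟨C, _, h⟩ := exists_bound_iteratedFDeriv_rightCutoff i
    exact ⟨0, C, fun s => by simpa using h s⟩⟩

/-- The cutoff of `h` to a neighbourhood of `{p ≤ 0}`. -/
def nearCutoff (p : E → ℝ) (c : ℝ) (h : 𝓢(E, ℂ)) : 𝓢(E, ℂ) :=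
  SchwartzMap.smulLeftCLM ℂ (fun x => rightCutoff (c * p x)) h

theorem rightCutoff_comp_temperate {p : E → ℝ} (hp : p.HasTemperateGrowth) (c : ℝ) :
    Function.HasTemperateGrowth fun x => rightCutoff (c * p x) :=
  rightCutoff_temperate.comp ((Function.HasTemperateGrowth.const c).mul hp)

theorem nearCutoff_apply {p : E → ℝ} (hp : p.HasTemperateGrowth) (c : ℝ) (h : 𝓢(E, ℂ)) (x : E) :
    nearCutoff p c h x = rightCutoff (c * p x) • h x :=
  SchwartzMap.smulLeftCLM_apply_apply (rightCutoff_comp_temperate hp c) h x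

/-- The Faà di Bruno estimate, keeping track of the power of `c`. -/
theorem exists_bound_iteratedFDeriv_rightCutoff_comp {p : E → ℝ} (hp : p.HasTemperateGrowth)
    (n : ℕ) : ∃ (m : ℕ) (C : ℝ), 0 ≤ C ∧ ∀ (c : ℝ), 1 ≤ c → ∀ i ≤ n, ∀ x,
      ‖iteratedFDeriv ℝ i (fun x => rightCutoff (c * p x)) x‖ ≤ C * c ^ n * (1 + ‖x‖) ^ m := by
  obtain ⟨m, C, hC, h⟩ := hp.norm_iteratedFDeriv_le_uniform n
  choose B hB hB' using exists_bound_iteratedFDeriv_rightCutoff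
  set B' := ∑ i ∈ Finset.range (n + 1), B i
  have hB'0 : 0 ≤ B' := Finset.sum_nonneg fun i _ => hB i
  refine ⟨m * n, n.factorial * B' * (C + 1) ^ n, by positivity, fun c hc i hi x => ?_⟩
  set D := c * (C + 1) * (1 + ‖x‖) ^ m
  have hx1 : 1 ≤ (1 + ‖x‖) ^ m := one_le_pow₀ (by linarith [norm_nonneg x])
  have hD1 : 1 ≤ D := one_le_mul_of_one_le_of_one_le
    (one_le_mul_of_one_le_of_one_le hc (by linarith)) hx1
  have h1 : ∀ j ≤ i, ‖iteratedFDeriv ℝ j rightCutoff (c * p x)‖ ≤ B' := fun j hj =>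
    (hB' j _).trans (Finset.single_le_sum (f := B) (fun i _ => hB i)
      (Finset.mem_range.2 (by omega)))
  have h2 : ∀ j, 1 ≤ j → j ≤ i → ‖iteratedFDeriv ℝ j (fun x => c * p x) x‖ ≤ D ^ j := by
    intro j hj hji
    have h3 : iteratedFDeriv ℝ j (fun x => c * p x) x = c • iteratedFDeriv ℝ j p x :=
      iteratedFDeriv_const_smul_apply (f := p) (a := c) (hp.1.contDiffAt.of_le (mod_cast le_top))
    rw [h3, norm_smul, Real.norm_of_nonneg (by linarith)]
    calc c * ‖iteratedFDeriv ℝ j p x‖ ≤ c * ((C + 1) * (1 + ‖x‖) ^ m) := by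
          gcongr
          refine (h j (hji.trans hi) x).trans ?_
          gcongr
          linarith
      _ = D := by ring
      _ ≤ D ^ j := le_self_pow₀ hD1 (by omega)
  have h3 := norm_iteratedFDeriv_comp_le (g := rightCutoff) (f := fun x => c * p x)
    rightCutoff_contDiff (contDiff_const.mul hp.1) (mod_cast le_top) x h1 h2
  calc ‖iteratedFDeriv ℝ i (fun x => rightCutoff (c * p x)) x‖
      ≤ i.factorial * B' * D ^ i := h3
    _ ≤ n.factorial * B' * D ^ n := by
        gcongr
    _ = _ := by simp only [D, mul_pow]; rw [← pow_mul]; ring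

theorem exists_seminorm_nearCutoff_le {p : E → ℝ} (hp : p.HasTemperateGrowth) {h : 𝓢(E, ℂ)}
    (hh : ∀ ε : ℝ, 0 < ε → ε ≤ 1 → ∀ x, p x ≤ ε ^ 2 → ∃ z, h =ᶠ[𝓝 z] 0 ∧ ‖x - z‖ ≤ ε)
    (k n : ℕ) : ∃ C, 0 ≤ C ∧ ∀ ε : ℝ, 0 < ε → ε ≤ 1 →
      SchwartzMap.seminorm ℂ k n (nearCutoff p (ε ^ 2)⁻¹ h) ≤ C * ε := by
  obtain ⟨m, C, hC, hcut⟩ := exists_bound_iteratedFDeriv_rightCutoff_comp hp n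
  -- Derivatives of the cutoff cost up to `ε ^ (-2n)`, so flatness of order `2n + 1` leaves one
  -- factor `ε`; the weight `k + m` absorbs their polynomial growth.
  choose B hB hflat using fun i => exists_bound_of_eventually_zero h (2 * n + 1) (k + m) i
  refine ⟨∑ i ∈ Finset.range (n + 1), n.choose i * C * B (n - i),
    Finset.sum_nonneg fun i _ => by have := hB (n - i); positivity, fun ε hε hε1 => ?_⟩
  refine SchwartzMap.seminorm_le_bound ℂ k n _ (mul_nonneg (Finset.sum_nonneg fun i _ => by
    have := hB (n - i); positivity) hε.le) fun x => ?_
  set c := (ε ^ 2)⁻¹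
  have hc1 : 1 ≤ c := (one_le_inv₀ (by positivity)).2 (pow_le_one₀ hε.le hε1)
  have hco : ⇑(nearCutoff p c h) = fun x => rightCutoff (c * p x) • h x :=
    funext (nearCutoff_apply hp c h)
  rcases le_or_gt (p x) (ε ^ 2) with hx | hx
  · obtain ⟨z, hz, hxz⟩ := hh ε hε hε1 x hx
    have h1 := norm_iteratedFDeriv_smul_le (rightCutoff_comp_temperate hp c).1 (h.smooth ⊤) x
      (n := n) (mod_cast le_top)
    rw [hco]
    calc ‖x‖ ^ k * ‖iteratedFDeriv ℝ n (fun x => rightCutoff (c * p x) • h x) x‖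
        ≤ (1 + ‖x‖) ^ k * ∑ i ∈ Finset.range (n + 1), (n.choose i : ℝ) *
          ‖iteratedFDeriv ℝ i (fun x => rightCutoff (c * p x)) x‖ *
            ‖iteratedFDeriv ℝ (n - i) h x‖ := by
          gcongr
          linarith
      _ = ∑ i ∈ Finset.range (n + 1), (1 + ‖x‖) ^ k * ((n.choose i : ℝ) *
          ‖iteratedFDeriv ℝ i (fun x => rightCutoff (c * p x)) x‖ *
            ‖iteratedFDeriv ℝ (n - i) h x‖) := Finset.mul_sum _ _ _
      _ ≤ ∑ i ∈ Finset.range (n + 1), n.choose i * C * B (n - i) * ε := by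
          refine Finset.sum_le_sum fun i hi => ?_
          have hi' : i ≤ n := by simpa [Nat.lt_succ_iff] using hi
          calc (1 + ‖x‖) ^ k * ((n.choose i : ℝ) *
                ‖iteratedFDeriv ℝ i (fun x => rightCutoff (c * p x)) x‖ *
                ‖iteratedFDeriv ℝ (n - i) h x‖)
              ≤ (1 + ‖x‖) ^ k * ((n.choose i : ℝ) * (C * c ^ n * (1 + ‖x‖) ^ m) *
                ‖iteratedFDeriv ℝ (n - i) h x‖) := by
                gcongr
                exact hcut c hc1 i hi' x
            _ = n.choose i * C * c ^ n *
                ((1 + ‖x‖) ^ (k + m) * ‖iteratedFDeriv ℝ (n - i) h x‖) := by ring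
            _ ≤ n.choose i * C * c ^ n * (B (n - i) * ε ^ (2 * n + 1)) :=
                mul_le_mul_of_nonneg_left (hflat (n - i) x z ε hε.le hε1 hz hxz) (by positivity)
            _ = n.choose i * C * B (n - i) * ε * (c ^ n * ε ^ (2 * n)) := by ring
            _ = _ := by
                have : c ^ n * ε ^ (2 * n) = 1 := by
                  rw [pow_mul, ← mul_pow, inv_mul_cancel₀ (by positivity), one_pow]
                rw [this, mul_one]
      _ = _ := (Finset.sum_mul _ _ _).symm
  · have hz : ⇑(nearCutoff p c h) =ᶠ[𝓝 x] 0 := by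
      filter_upwards [hp.1.continuous.continuousAt.eventually (lt_mem_nhds hx)] with y hy
      have : 1 ≤ c * p y := by
        rw [inv_mul_eq_div, one_le_div (by positivity)]
        exact hy.le
      simp [hco, rightCutoff_of_ge this]
    rw [(hz.iteratedFDeriv ℝ n).eq_of_nhds]
    have h0 : iteratedFDeriv ℝ n (0 : E → ℂ) x = 0 := by simp
    rw [h0, norm_zero, mul_zero]
    exact mul_nonneg (Finset.sum_nonneg fun i _ => by have := hB (n - i); positivity) hε.le

/-- Removing from `h` its cutoff to `p ≤ ε²` leaves a function supported in `p ≥ ε²/2`, inside `U`,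
which `T` kills. The cutoff part has all seminorms `O(ε)`, so `T h = 0` in the limit. -/
theorem _root_.Distribution.IsVanishingOn.apply_eq_zero {T : 𝓢'(E, ℂ)} {U : Set E}
    (hT : IsVanishingOn T U) {p : E → ℝ} (hp : p.HasTemperateGrowth) (hpU : ∀ x, 0 < p x → x ∈ U)
    {h : 𝓢(E, ℂ)}
    (hh : ∀ ε : ℝ, 0 < ε → ε ≤ 1 → ∀ x, p x ≤ ε ^ 2 → ∃ z, h =ᶠ[𝓝 z] 0 ∧ ‖x - z‖ ≤ ε) :
    T h = 0 := by
  have h1 : ∀ ε : ℝ, 0 < ε → T h = T (nearCutoff p (ε ^ 2)⁻¹ h) := by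
    intro ε hε
    rw [← sub_eq_zero, ← map_sub]
    refine hT _ ?_
    have hcl : IsClosed {x | ε ^ 2 / 2 ≤ p x} := isClosed_le continuous_const hp.1.continuous
    refine (closure_minimal (fun x hx => ?_) hcl).trans fun x hx =>
      hpU x (lt_of_lt_of_le (by positivity) hx)
    by_contra hx'
    refine hx ?_
    have h2 : (ε ^ 2)⁻¹ * p x ≤ 1 / 2 := by
      rw [inv_mul_eq_div, div_le_iff₀ (by positivity)]
      have : p x < ε ^ 2 / 2 := lt_of_not_ge hx'
      linarith
    rw [sub_apply, nearCutoff_apply hp, rightCutoff_of_le h2, one_smul, sub_self]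
  obtain ⟨s, C, _, hTs⟩ := Seminorm.bound_of_continuous (schwartz_withSeminorms ℂ E ℂ)
    ((normSeminorm ℂ ℂ).comp (T : 𝓢(E, ℂ) →L[ℂ] ℂ).toLinearMap) (continuous_norm.comp T.continuous)
  choose K hK hKb using fun kn : ℕ × ℕ => exists_seminorm_nearCutoff_le hp hh kn.1 kn.2
  have hsup : ∀ ε : ℝ, 0 < ε → ε ≤ 1 → ‖T h‖ ≤ C * (∑ i ∈ s, K i) * ε := by
    intro ε hε hε1
    rw [h1 ε hε]
    refine (hTs _).trans ?_
    change C * (s.sup (schwartzSeminormFamily ℂ E ℂ)) (nearCutoff p (ε ^ 2)⁻¹ h) ≤ _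
    rw [mul_assoc]
    gcongr
    refine Seminorm.finset_sup_apply_le (mul_nonneg (Finset.sum_nonneg fun i _ => hK i) hε.le)
      fun i hi => (hKb i ε hε hε1).trans ?_
    gcongr
    exact Finset.single_le_sum (fun i _ => hK i) hi
  have hlim : Tendsto (fun ε : ℝ => C * (∑ i ∈ s, K i) * ε) (𝓝[>] 0) (𝓝 0) := by
    have : Tendsto (fun ε : ℝ => C * (∑ i ∈ s, K i) * ε) (𝓝 0) (𝓝 (C * (∑ i ∈ s, K i) * 0)) :=
      (continuous_const.mul continuous_id).tendsto 0
    rw [mul_zero] at this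
    exact this.mono_left nhdsWithin_le_nhds
  have := ge_of_tendsto hlim (b := ‖T h‖) (by
    filter_upwards [Ioc_mem_nhdsGT (zero_lt_one' ℝ)] with ε hε using hsup ε hε.1 hε.2)
  exact norm_le_zero_iff.1 this

end Flat

/-! ### Testing cone distributions, and the main theorem. -/

theorem fourierD_apply (g : 𝓢'(Space, ℂ)) (f : 𝓢(Space, ℂ)) : fourierD g f = g (fourierS f) := rfl

theorem norm_pt_sub_pt (a b : ℝ) (σ : Plane) : ‖pt a σ - pt b σ‖ = |a - b| := by
  have h : pt a σ - pt b σ = pt (a - b) 0 := by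
    apply WithLp.ofLp_injective; simp [pt]
  rw [h, norm_pt]
  simp [Real.sqrt_sq_eq_abs]

theorem apply_reflectCLM_eq_zero {g : 𝓢'(Space, ℂ)} (hg : IsVanishingOn g {x : Space | x.fst < 0})
    (φ : SPlus) : g (reflectCLM φ) = 0 := by
  -- The factor `2` makes `t ≥ -ε²/2 > -ε` strict, even for `ε = 1`, so moving by `ε` reaches the
  -- open half-space `t > 0`.
  refine hg.apply_eq_zero (p := fun x => (-2 : ℝ) * x.fst) ((Function.HasTemperateGrowth.const _).mul
    fstC.hasTemperateGrowth) (fun x hx => ?_) fun ε hε hε1 x hx => ⟨pt (x.fst + ε) x.snd, ?_, ?_⟩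
  · change x.fst < 0
    linarith
  · have h0 : 0 < (pt (x.fst + ε) x.snd).fst := by rw [pt_fst]; nlinarith
    filter_upwards [continuous_fst.continuousAt.eventually (lt_mem_nhds h0)] with y hy
    exact φ.2 _ _ (neg_lt_zero.2 hy)
  · have h := norm_pt_sub_pt x.fst (x.fst + ε) x.snd
    rw [pt_fst_snd] at h
    simp [h, abs_of_pos hε]

theorem coneQuadratic_temperate :
    Function.HasTemperateGrowth fun x : Space => 4 * (‖x.snd‖ ^ 2 - x.fst ^ 2) := by
  have h1 : Function.HasTemperateGrowth fun x : Space => x.fst := fstC.hasTemperateGrowth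
  have h2 : Function.HasTemperateGrowth fun x : Space => ‖x.snd‖ ^ 2 :=
    Function.HasTemperateGrowth.comp (f := fun x : Space => x.snd)
      (Function.hasTemperateGrowth_norm_sq Plane) sndC.hasTemperateGrowth
  exact (Function.HasTemperateGrowth.const 4).mul (h2.sub (h1.pow 2))

theorem apply_eq_zero_of_fourierS_eq_zero {g : 𝓢'(Space, ℂ)}
    (hg : IsVanishingOn (fourierD g) {η : Space | |η.fst| < ‖η.snd‖}) {u : 𝓢(Space, ℂ)}
    (hu : ∀ (ω : ℝ) (σ : Plane), ‖σ‖ ≤ |ω| → fourierS u (pt ω σ) = 0) : g u = 0 := by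
  rw [← fourierS_fourierSInv u, ← fourierD_apply]
  refine hg.apply_eq_zero coneQuadratic_temperate (fun x hx => ?_) fun ε hε hε1 x hx => ?_
  · have : x.fst ^ 2 < ‖x.snd‖ ^ 2 := by linarith
    have := sq_lt_sq.1 this
    rwa [abs_norm] at this
  -- The factor `4` in the quadratic form gives `|σ|² ≤ ω² + ε²/4`, so the inequality stays strict
  -- at `ω = 0`. Moving `ω` outward by `ε` then lands in the open cone.
  · have hlt : ‖x.snd‖ < |x.fst| + ε := by
      refine lt_of_pow_lt_pow_left₀ 2 (by positivity) ?_
      rw [add_sq, sq_abs]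
      nlinarith [abs_nonneg x.fst]
    obtain ⟨a, ha, hax⟩ : ∃ a, |a| = |x.fst| + ε ∧ |x.fst - a| = ε := by
      rcases le_total 0 x.fst with h | h
      · exact ⟨x.fst + ε, by rw [abs_of_nonneg h, abs_of_nonneg (by linarith)],
          by simp [abs_of_pos hε]⟩
      · exact ⟨x.fst - ε, by rw [abs_of_nonpos h, abs_of_nonpos (by linarith)]; ring,
          by simp [abs_of_pos hε]⟩
    refine ⟨pt a x.snd, ?_, ?_⟩
    · have hopen : IsOpen {y : Space | ‖y.snd‖ < |y.fst|} :=
        isOpen_lt continuous_snd.norm continuous_fst.abs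
      have hmem : pt a x.snd ∈ {y : Space | ‖y.snd‖ < |y.fst|} := by
        change ‖(pt a x.snd).snd‖ < |(pt a x.snd).fst|
        rwa [pt_fst, pt_snd, ha]
      filter_upwards [hopen.mem_nhds hmem] with y hy
      -- The inverse transform differs from the transform by `y ↦ -y`, which preserves the cone.
      rw [fourierSInv_apply]
      have h1 : -y = pt (-y.fst) (-y.snd) := rfl
      rw [h1, hu]
      · rfl
      · rw [norm_neg, abs_neg]; exact le_of_lt hy
    · have h := norm_pt_sub_pt x.fst a x.snd
      rw [pt_fst_snd] at h
      rw [h, hax]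

/-- The point `(sgn ω √(ω² - |σ|²), σ)` has norm `|ω|`, so the formula for `R*` evaluates the
transform of the odd part at `(|ω|, σ)`; oddness restores the sign. At `ω = 0` both sides vanish. -/
theorem fourierS_coneFormula_rStarPlus {E : SEven →L[ℂ] SOdd}
    (hE : ConeFormula (2 * Complex.I) E) (φ : SPlus) {ω : ℝ} {σ : Plane} (h : ‖σ‖ ≤ |ω|) :
    fourierS (E (rStarPlus φ)) (pt ω σ) = fourierS (oddPart φ) (pt ω σ) := by
  rw [hE _ _ _ h]
  have hodd := fourierS_mem_SOdd (oddPart_mem_SOdd φ)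
  rcases eq_or_ne ω 0 with rfl | hω
  · have h1 := hodd 0 σ
    rw [neg_zero] at h1
    rw [self_eq_neg.1 h1]
    simp
  have h0 : 0 ≤ ω ^ 2 - ‖σ‖ ^ 2 := by
    rw [sub_nonneg, ← sq_abs ω]; gcongr
  have hsign : Real.sign ω ^ 2 = 1 := by
    rcases Real.sign_apply_eq_of_ne_zero ω hω with h | h <;> rw [h] <;> norm_num
  have hn : ‖pt (Real.sign ω * √(ω ^ 2 - ‖σ‖ ^ 2)) σ‖ = |ω| := by
    rw [norm_pt, mul_pow, hsign, one_mul, Real.sq_sqrt h0, add_sub_cancel, Real.sqrt_sq_eq_abs]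
  have hne : pt (Real.sign ω * √(ω ^ 2 - ‖σ‖ ^ 2)) σ ≠ 0 := by
    rw [← norm_ne_zero_iff, hn]; exact abs_ne_zero.2 hω
  rw [rStarPlus_coe, fourierS_rStarOdd (oddPart_mem_SOdd _) hne, hn, pt_snd]
  have hωc : (ω : ℂ) ≠ 0 := by exact_mod_cast hω
  rcases abs_choice ω with h | h <;> rw [h]
  · field_simp [Complex.I_ne_zero]
  · rw [hodd]
    push_cast
    field_simp [Complex.I_ne_zero]

theorem apply_coneFormula_rStarPlus {E : SEven →L[ℂ] SOdd} (hE : ConeFormula (2 * Complex.I) E)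
    {g : 𝓢'(Space, ℂ)} (hg : g ∈ SCone) (φ : SPlus) : g (E (rStarPlus φ)) = g φ := by
  have h1 : g ((E (rStarPlus φ) : 𝓢(Space, ℂ)) - oddPart φ) = 0 :=
    apply_eq_zero_of_fourierS_eq_zero hg.2 fun ω σ h => by
      rw [map_sub, sub_apply, fourierS_coneFormula_rStarPlus hE φ h, sub_self]
  rw [map_sub, oddPart_eq, map_sub, apply_reflectCLM_eq_zero hg.1, sub_zero, sub_eq_zero] at h1
  exact h1

end ConeInverse

end

open ConeInverse
theorem mainTheorem9 :
    ∃ (E₂ : SEven →L[ℂ] 𝓢(Space, ℂ)) (E₁ : 𝓢(Space, ℂ) →L[ℂ] SOdd) (Rs : SPlus →L[ℂ] SEven),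
      -- `E₂ ψ` is a continuous extension of `ψ(√ω, σ)`, `ω ≥ 0`, to a Schwartz function
      (∀ (ψ : SEven) (ω : ℝ) (σ : Plane), 0 ≤ ω →
        E₂ ψ (pt ω σ) = (ψ : 𝓢(Space, ℂ)) (pt (√ω) σ)) ∧
      (∀ (χ : 𝓢(Space, ℂ)) (ω : ℝ) (σ : Plane),
        (E₁ χ : 𝓢(Space, ℂ)) (pt ω σ) = ω * χ (pt (ω ^ 2 - ‖σ‖ ^ 2) σ)) ∧
      -- `R*` maps `𝓢(ℝ⁺ × ℝ²)` continuously to the even Schwartz functions, and in frequency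
      -- it is a difference quotient on the light cone
      (∀ (φ : SPlus) (x : Space), (Rs φ : 𝓢(Space, ℂ)) x = rStar φ x) ∧
      (∀ (φ : SPlus) (ϱ : ℝ) (σ : Plane), pt ϱ σ ≠ 0 →
        fourierS (Rs φ) (pt ϱ σ) =
          (1 / (2 * Complex.I)) *
            ((fourierS φ (pt (√(‖σ‖ ^ 2 + ϱ ^ 2)) σ) - fourierS φ (pt (-√(‖σ‖ ^ 2 + ϱ ^ 2)) σ)) /
              (√(‖σ‖ ^ 2 + ϱ ^ 2) : ℂ))) ∧
      -- existence of `E`, for every normalisation `c`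
      (∀ c : ℂ, ∃ E : SEven →L[ℂ] SOdd,
        (∀ ψ : SEven, fourierS (E ψ) = c • (E₁ (E₂ (fourierEven ψ)) : 𝓢(Space, ℂ))) ∧
        ConeFormula c E) ∧
      -- every such `E` with `c = 2i` inverts `R*`
      (∀ E : SEven →L[ℂ] SOdd, ConeFormula (2 * Complex.I) E →
        (∀ (ψ : SEven) (x : Space), rStar (E ψ) x = (ψ : 𝓢(Space, ℂ)) x) ∧
        (∀ g ∈ SCone, ∀ φ : SPlus, g (E (Rs φ)) = g φ)) :=
  ⟨sqrtExt, coneComp, rStarPlus, fun ψ _ σ hω => sqrtExt_apply ψ hω σ, coneComp_apply,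
    rStarPlus_apply, fourierS_rStarPlus,
    fun c => ⟨coneExt c, fourierS_coneExt c, coneFormula_of_fourierS_eq (fourierS_coneExt c)⟩,
    fun _ hE => ⟨rStar_of_coneFormula hE, fun _ hg φ => apply_coneFormula_rStarPlus hE hg φ⟩⟩
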